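/- For $x\in\mathbb R$ (or $x\in\mathbb T=\mathbb R/\mathbb Z$) let $\|x\|$ denote the distance from $x$ to the nearest integer, and let $\mathrm{mes}$ be Lebesgue measure on $\mathbb T$, with $\mathrm{mes}\,\mathbb T=1$. For every $A\in\mathbb R$ there is $\sigma=\sigma(A)>0$ such that for all $c>0$ and $B\in\mathbb R$ there is $\tilde c=\tilde c(A,c,B)>0$ with the following property. Let $u:\mathbb T\to\mathbb R$, regarded as a 1-periodic function on $\mathbb R$, have an extension $\tilde u$ to the strip $|\mathrm{Im}\,z|<1$ that is subharmonic there and satisfies $|\tilde u|\le B$, and put $\hat u(0)=\int_{\mathbb T}u(x)\,dx$. Let $M\ge 1$ be an integer and let $\omega\in\mathbb T$ satisfy $$\|k\omega\|>c|k|^{-A}\qquad\text{for all } k\in\mathbb Z \text{ with } 0<|k|\le M.$$ Then $$\mathrm{mes}\Big\{x\in\mathbb T:\ \Big|\sum_{|m|<M}\frac{M-|m|}{M^2}\,u(x+m\omega)-\hat u(0)\Big|>M^{-\sigma}\Big\}<e^{-\tilde c M^{\sigma}}.$$ In particular, if $\|k\omega\|>c|k|^{-A}$ holds for all $k\in\mathbb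 Z\setminus\{0\}$, then this estimate holds for all integers $M\ge1$, with $\sigma$ depending only on $A$ and $\tilde c$ only on $A,c,B$. -/

import Mathlib

/-- A real-valued function `f` is subharmonic on the open set `U ⊆ ℂ` if it is upper
semicontinuous on `U` and its value at the centre of any closed disc contained in `U` is at most
its average over the boundary circle. (For a subharmonic function that is finite everywhere these
averages are finite, so integrability on the circles is part of the notion.) -/
structure SubharmonicOn (f : ℂ → ℝ) (U : Set ℂ) : Prop where
  isOpen : IsOpen U
  upperSemicontinuousOn : UpperSemicontinuousOn f U
  circleIntegrable : ∀ (z : ℂ) (r : ℝ), 0 < r → Metric.closedBall z r ⊆ U → CircleIntegrable f z r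
  le_circleAverage : ∀ (z : ℂ) (r : ℝ), 0 < r → Metric.closedBall z r ⊆ U →
    f z ≤ Real.circleAverage f z r

/-- `v` is a subharmonic extension, bounded by `B` in absolute value, of the 1-periodic function
`u` to the strip `|Im z| < 1`. -/
structure IsBoundedSubharmonicExtension (v : ℂ → ℝ) (u : UnitAddCircle → ℝ) (B : ℝ) : Prop where
  subharmonicOn : SubharmonicOn v {z : ℂ | |z.im| < 1}
  abs_le : ∀ z : ℂ, |z.im| < 1 → |v z| ≤ B
  extends_real : ∀ x : ℝ, v (x : ℂ) = u (x : UnitAddCircle)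

/-- The Fejér-weighted average `∑_{|m| < M} (M - |m|) / M² · u (x + m ω)` along the rotation by
`ω`. -/
noncomputable def fejerAverage (u : UnitAddCircle → ℝ) (ω : UnitAddCircle) (M : ℕ)
    (x : UnitAddCircle) : ℝ :=
  ∑ m ∈ Finset.Ioo (-(M : ℤ)) (M : ℤ), ((M : ℝ) - |(m : ℝ)|) / (M : ℝ) ^ 2 * u (x + m • ω)

/-!
A bounded subharmonic function has a trace `u` on the real line with finite half-derivative energy
`∑ |k| ‖û(k)‖²`. Indeed, let `w ≥ 0` be the subharmonic function shifted by its bound, and let `φ`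
be a Lipschitz cutoff whose integer translates sum to one on the real line. In
`∫ |φ w (z + h) - φ w (z)|²` the sub-mean value property makes the cross terms nonpositive on
average over `‖h‖ = r`, and what is left is `O(r²)`. This bounds `∑ (k² + l²) ‖a k l‖²` for the
plane Fourier coefficients `a` of `φ w`. As `∑ l, |k| / (k² + l²)` is bounded in `k ≠ 0`,
Cauchy–Schwarz controls the energy of the slice on almost every horizontal line. The real line is
not exceptional: circle averages of `φ w` converge pointwise to `φ w`.

The Fejér average multiplies `û(k)` by `‖M⁻¹ ∑ j < M, e(j k ω)‖²`. The Diophantine condition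
separates the points `k ω` with `k` in a short block, so the multiplier is small on average over
such a block. With `X = M ^ σ`, Cauchy–Schwarz against the energy shows that the frequencies
`0 < |k| ≤ exp X` contribute less than `X⁻¹` in sup norm, while the energy of the higher
frequencies is so small that Chebyshev's inequality gives an exponentially small exceptional set.

For the remaining bounded range of `M` it suffices that the exceptional set misses a set of
measure bounded below: if a function `g` of mean zero and bounded energy had `|g| > ε` off a very
small set, then at a suitable dyadic scale the sign of `g` would be almost translation invariant,
contradicting mean zero.
-/

open MeasureTheory Filter Topology AddCircle
open scoped symmDiff

section FourierCoefficients

theorem haarAddCircle_eq_volume : (haarAddCircle : Measure UnitAddCircle) = volume := by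
  simp [volume_eq_smul_haarAddCircle]

theorem fourierCoeff_eq_integral_volume (f : UnitAddCircle → ℂ) (k : ℤ) :
    fourierCoeff f k = ∫ x : UnitAddCircle, fourier (-k) x * f x := by
  rw [fourierCoeff, haarAddCircle_eq_volume]
  rfl

theorem fourierCoeff_ofReal_zero (u : UnitAddCircle → ℝ) :
    fourierCoeff (fun x => (u x : ℂ)) 0 = ((∫ x, u x : ℝ) : ℂ) := by
  simpa [fourierCoeff_eq_integral_volume] using integral_ofReal (𝕜 := ℂ) (f := u)

theorem norm_fourier_apply (k : ℤ) (x : UnitAddCircle) : ‖(fourier k x : ℂ)‖ = 1 := by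
  rw [fourier_apply, Circle.norm_coe]

theorem fourier_add_apply (k : ℤ) (x y : UnitAddCircle) :
    (fourier k (x + y) : ℂ) = fourier k x * fourier k y := by
  simp only [fourier_apply, smul_add, toCircle_add, Circle.coe_mul]

theorem fourier_zsmul_apply (k m : ℤ) (x : UnitAddCircle) :
    (fourier k (m • x) : ℂ) = (fourier k x : ℂ) ^ m := by
  rw [fourier_apply, fourier_apply, smul_comm, toCircle_zsmul, Circle.coe_zpow]

theorem fourierCoeff_comp_add_right (f : UnitAddCircle → ℂ) (t : UnitAddCircle) (k : ℤ) :
    fourierCoeff (fun x => f (x + t)) k = fourier k t * fourierCoeff f k := by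
  rw [fourierCoeff_eq_integral_volume, fourierCoeff_eq_integral_volume,
    ← integral_add_right_eq_self (fun x => fourier (-k) x * f x) t, ← integral_const_mul]
  refine integral_congr_ae (.of_forall fun x => ?_)
  have h : (fourier k t : ℂ) * fourier (-k) t = 1 := by rw [← fourier_add]; simp
  simp only [fourier_add_apply]
  linear_combination (-(fourier (-k) x * f (x + t))) * h

theorem hasSum_sq_fourierCoeff_of_memLp {f : UnitAddCircle → ℂ} (hf : MemLp f 2) :
    HasSum (fun k => ‖fourierCoeff f k‖ ^ 2) (∫ x, ‖f x‖ ^ 2) := by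
  rw [← haarAddCircle_eq_volume] at hf ⊢
  have h := hasSum_sq_fourierCoeff hf.toLp
  rw [fourierCoeff_congr_ae hf.coeFn_toLp] at h
  convert h using 1
  refine integral_congr_ae ?_
  filter_upwards [hf.coeFn_toLp] with x hx
  rw [hx]

theorem fourierCoeff_sub {f g : UnitAddCircle → ℂ} (hf : Integrable f) (hg : Integrable g)
    (k : ℤ) : fourierCoeff (fun x => f x - g x) k = fourierCoeff f k - fourierCoeff g k := by
  rw [← haarAddCircle_eq_volume] at hf hg
  have h := congr_fun (fourierCoeff.add hf (hg.const_mul (-1))) k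
  simp only [Pi.add_apply, fourierCoeff.const_mul] at h
  rw [sub_eq_add_neg, neg_eq_neg_one_mul, ← h]
  congr 1
  ext x
  simp only [Pi.add_apply]
  ring

theorem integrable_fourier (k : ℤ) : Integrable (fun x : UnitAddCircle => (fourier k x : ℂ)) :=
  (map_continuous (fourier k)).integrable_of_hasCompactSupport (.of_compactSpace _)

theorem fourierCoeff_sum_mul_fourier (S : Finset ℤ) (a : ℤ → ℂ) (k : ℤ) :
    fourierCoeff (fun x : UnitAddCircle => ∑ j ∈ S, a j * fourier j x) k =
      if k ∈ S then a k else 0 := by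
  have h : (fun x : UnitAddCircle => ∑ j ∈ S, a j * fourier j x) =
      ∑ j ∈ S, fun x : UnitAddCircle => a j * fourier j x := by
    ext x
    rw [Finset.sum_apply]
  rw [h, fourierCoeff.sum _ _ fun j _ => by
    rw [haarAddCircle_eq_volume]; exact (integrable_fourier j).const_mul _, Finset.sum_apply]
  simp only [fourierCoeff.const_mul, fourierCoeff_fourier, Pi.single_apply, mul_ite, mul_one,
    mul_zero, Finset.sum_ite_eq]

/-- The `S`-partial sum of the Fourier series of `f`. -/
noncomputable def fourierPartialSum (f : UnitAddCircle → ℂ) (S : Finset ℤ)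
    (x : UnitAddCircle) : ℂ :=
  ∑ k ∈ S, fourierCoeff f k * fourier k x

theorem memLp_fourierPartialSum (f : UnitAddCircle → ℂ) (S : Finset ℤ) :
    MemLp (fourierPartialSum f S) 2 := by
  have h : Continuous (fourierPartialSum f S) := by unfold fourierPartialSum; fun_prop
  exact h.memLp_of_hasCompactSupport (.of_compactSpace _)

theorem fourierCoeff_sub_fourierPartialSum {f : UnitAddCircle → ℂ} (hf : Integrable f)
    (S : Finset ℤ) (k : ℤ) :
    fourierCoeff (fun x => f x - fourierPartialSum f S x) k =
      if k ∈ S then 0 else fourierCoeff f k := by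
  rw [fourierCoeff_sub hf ((memLp_fourierPartialSum f S).integrable one_le_two)]
  unfold fourierPartialSum
  rw [fourierCoeff_sum_mul_fourier]
  split_ifs <;> simp

theorem integral_sq_norm_sub_fourierPartialSum_le {f : UnitAddCircle → ℂ} (hf : MemLp f 2)
    {S : Finset ℤ} {V : ℝ} (hV : ∀ T, Disjoint S T → ∑ k ∈ T, ‖fourierCoeff f k‖ ^ 2 ≤ V) :
    ∫ x, ‖f x - fourierPartialSum f S x‖ ^ 2 ≤ V := by
  refine hasSum_le_of_sum_le
    (hasSum_sq_fourierCoeff_of_memLp (hf.sub (memLp_fourierPartialSum f S))) fun T => ?_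
  refine le_trans (le_of_eq ?_) (hV (T \ S) Finset.disjoint_sdiff)
  rw [Finset.sdiff_eq_filter, Finset.sum_filter]
  refine Finset.sum_congr rfl fun k _ => ?_
  rw [fourierCoeff_sub_fourierPartialSum (hf.integrable one_le_two)]
  split_ifs <;> simp_all

theorem norm_fourierPartialSum_sub_fourierCoeff_zero_le (f : UnitAddCircle → ℂ) {S : Finset ℤ}
    (h0 : 0 ∈ S) (x : UnitAddCircle) :
    ‖fourierPartialSum f S x - fourierCoeff f 0‖ ≤ ∑ k ∈ S.erase 0, ‖fourierCoeff f k‖ := by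
  rw [fourierPartialSum, ← Finset.add_sum_erase S _ h0, fourier_zero, mul_one, add_sub_cancel_left]
  refine (norm_sum_le _ _).trans_eq (Finset.sum_congr rfl fun k _ => ?_)
  rw [norm_mul, norm_fourier_apply, mul_one]

theorem measureReal_le_norm_le_integral_sq_div {α E : Type*} [MeasurableSpace α] {μ : Measure α}
    [NormedAddCommGroup E] {g : α → E} (hg : MemLp g 2 μ) {l : ℝ}
    (hl : 0 < l) : μ.real {x | l ≤ ‖g x‖} ≤ (∫ x, ‖g x‖ ^ 2 ∂μ) / l ^ 2 := by
  have h := mul_meas_ge_le_integral_of_nonneg (.of_forall fun x => sq_nonneg ‖g x‖)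
    (hg.integrable_norm_pow two_ne_zero) (l ^ 2)
  simp only [pow_le_pow_iff_left₀ hl.le (norm_nonneg _) two_ne_zero] at h
  rwa [le_div_iff₀' (by positivity)]

theorem measureReal_lt_norm_sub_fourierCoeff_zero_le {f : UnitAddCircle → ℂ} (hf : MemLp f 2)
    {S : Finset ℤ} (h0 : 0 ∈ S) {l V : ℝ} (hl : 0 < l)
    (hS : ∑ k ∈ S.erase 0, ‖fourierCoeff f k‖ ≤ l / 2)
    (hV : ∀ T, Disjoint S T → ∑ k ∈ T, ‖fourierCoeff f k‖ ^ 2 ≤ V) :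
    volume.real {x | l < ‖f x - fourierCoeff f 0‖} ≤ 4 * V / l ^ 2 := by
  have hsub : {x | l < ‖f x - fourierCoeff f 0‖} ⊆
      {x | l / 2 ≤ ‖f x - fourierPartialSum f S x‖} := fun x hx => by
    have htri := norm_sub_le_norm_sub_add_norm_sub (f x) (fourierPartialSum f S x)
      (fourierCoeff f 0)
    have hP := norm_fourierPartialSum_sub_fourierCoeff_zero_le f h0 x
    simp only [Set.mem_ofPred_eq] at hx ⊢
    linarith
  calc volume.real {x | l < ‖f x - fourierCoeff f 0‖}
      ≤ volume.real {x | l / 2 ≤ ‖f x - fourierPartialSum f S x‖} := measureReal_mono hsub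
    _ ≤ (∫ x, ‖f x - fourierPartialSum f S x‖ ^ 2) / (l / 2) ^ 2 :=
        measureReal_le_norm_le_integral_sq_div (hf.sub (memLp_fourierPartialSum f S))
          (half_pos hl)
    _ ≤ V / (l / 2) ^ 2 := by gcongr; exact integral_sq_norm_sub_fourierPartialSum_le hf hV
    _ = 4 * V / l ^ 2 := by ring

end FourierCoefficients

section FejerMultiplier

theorem sum_Ioo_neg_eq_add_sum_range {E : Type*} [AddCommGroup E] (f : ℤ → E) (M : ℕ) :
    ∑ m ∈ Finset.Ioo (-(M + 1 : ℤ)) (M + 1), f m =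
      f 0 + ∑ j ∈ Finset.range M, (f (j + 1) + f (-(j + 1))) := by
  induction M with
  | zero => simp [show Finset.Ioo (-1 : ℤ) 1 = {0} from rfl]
  | succ M ih =>
    have h : Finset.Ioo (-((M + 1 : ℕ) + 1 : ℤ)) ((M + 1 : ℕ) + 1) =
        insert (-(M + 1 : ℤ)) (insert (M + 1 : ℤ) (Finset.Ioo (-(M + 1 : ℤ)) (M + 1))) := by
      ext m
      simp only [Finset.mem_Ioo, Finset.mem_insert]
      omega
    rw [h, Finset.sum_insert (by simp; omega), Finset.sum_insert (by simp), ih,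
      Finset.sum_range_succ]
    abel

theorem sum_Ioo_triangle_mul_eq_sum_range_sub {R : Type*} [CommRing R] (f : ℤ → R) (M : ℕ) :
    ∑ m ∈ Finset.Ioo (-(M : ℤ)) M, ((M - |m| : ℤ) : R) * f m =
      ∑ i ∈ Finset.range M, ∑ j ∈ Finset.range M, f (i - j) := by
  induction M with
  | zero => simp
  | succ M ih =>
    have hext : ∑ m ∈ Finset.Ioo (-(M + 1 : ℤ)) (M + 1), ((M - |m| : ℤ) : R) * f m =
        ∑ m ∈ Finset.Ioo (-(M : ℤ)) M, ((M - |m| : ℤ) : R) * f m := by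
      symm
      refine Finset.sum_subset (Finset.Ioo_subset_Ioo (by omega) (by omega)) fun m hm hm' => ?_
      simp only [Finset.mem_Ioo] at hm hm'
      obtain rfl | rfl : m = M ∨ m = -M := by omega
      all_goals simp
    have hcast (m : ℤ) :
        ((M + 1 - |m| : ℤ) : R) * f m = ((M - |m| : ℤ) : R) * f m + f m := by
      push_cast
      ring
    simp only [Nat.cast_succ, hcast, Finset.sum_add_distrib]
    rw [hext, ih, sum_Ioo_neg_eq_add_sum_range]
    simp only [Finset.sum_range_succ, Finset.sum_add_distrib, sub_self]
    rw [← Finset.sum_range_reflect (fun j : ℕ => f (j + 1)),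
      ← Finset.sum_range_reflect (fun j : ℕ => f (-(j + 1)))]
    have hpos : ∑ j ∈ Finset.range M, f ((M - 1 - j : ℕ) + 1) = ∑ j ∈ Finset.range M, f (M - j) :=
      Finset.sum_congr rfl fun j hj => by congr 1; have := Finset.mem_range.1 hj; omega
    have hneg : ∑ j ∈ Finset.range M, f (-((M - 1 - j : ℕ) + 1)) =
        ∑ j ∈ Finset.range M, f (j - M) :=
      Finset.sum_congr rfl fun j hj => by congr 1; have := Finset.mem_range.1 hj; omega
    rw [hpos, hneg]
    ring

theorem fejerAverage_eq_sum_sum (u : UnitAddCircle → ℝ) (ω : UnitAddCircle) (M : ℕ)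
    (x : UnitAddCircle) :
    fejerAverage u ω M x = ((M : ℝ) ^ 2)⁻¹ *
      ∑ i ∈ Finset.range M, ∑ j ∈ Finset.range M, u (x + ((i : ℤ) - j) • ω) := by
  rw [← sum_Ioo_triangle_mul_eq_sum_range_sub (fun m : ℤ => u (x + m • ω)), fejerAverage,
    Finset.mul_sum]
  refine Finset.sum_congr rfl fun m _ => ?_
  push_cast
  ring

/-- The factor `|M⁻¹ ∑_{j < M} e(jkω)|²` by which `fejerAverage · ω M` multiplies the `k`-th
Fourier coefficient. -/
noncomputable def fejerMultiplier (ω : UnitAddCircle) (M : ℕ) (k : ℤ) : ℝ :=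
  (‖∑ j ∈ Finset.range M, (fourier k ω : ℂ) ^ j‖ / M) ^ 2

theorem fejerMultiplier_nonneg (ω : UnitAddCircle) (M : ℕ) (k : ℤ) : 0 ≤ fejerMultiplier ω M k :=
  sq_nonneg _

theorem fejerMultiplier_zero (ω : UnitAddCircle) {M : ℕ} (hM : M ≠ 0) :
    fejerMultiplier ω M 0 = 1 := by
  simp [fejerMultiplier, hM]

theorem fejerMultiplier_neg (ω : UnitAddCircle) (M : ℕ) (k : ℤ) :
    fejerMultiplier ω M (-k) = fejerMultiplier ω M k := by
  simp only [fejerMultiplier, fourier_neg, ← map_pow, ← map_sum, Complex.norm_conj]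

theorem fejerMultiplier_le_one (ω : UnitAddCircle) (M : ℕ) (k : ℤ) :
    fejerMultiplier ω M k ≤ 1 := by
  refine pow_le_one₀ (by positivity) (div_le_one_of_le₀ ?_ M.cast_nonneg)
  refine (norm_sum_le _ _).trans_eq ?_
  simp only [norm_pow, norm_fourier_apply, one_pow, Finset.sum_const, Finset.card_range,
    nsmul_eq_mul, mul_one]

theorem four_mul_norm_le_norm_toCircle_sub_one (t : UnitAddCircle) :
    4 * ‖t‖ ≤ ‖(toCircle t : ℂ) - 1‖ := by
  induction t using QuotientAddGroup.induction_on with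
  | H x =>
  have hx : ((x - round x : ℝ) : UnitAddCircle) = x := by
    rw [AddCircle.coe_sub, sub_eq_self]
    exact (AddCircle.coe_eq_zero_iff 1).2 ⟨round x, by simp⟩
  have hsin : 2 * |x - round x| ≤ |Real.sin (Real.pi * (x - round x))| := by
    have h := Real.mul_abs_le_abs_sin (x := Real.pi * (x - round x)) (by
      rw [abs_mul, abs_of_pos Real.pi_pos]
      nlinarith [Real.pi_pos, abs_sub_round x])
    rwa [abs_mul, abs_of_pos Real.pi_pos, ← mul_assoc, div_mul_cancel₀ _ Real.pi_ne_zero] at h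
  change 4 * ‖(x : UnitAddCircle)‖ ≤ ‖(toCircle (x : UnitAddCircle) : ℂ) - 1‖
  rw [UnitAddCircle.norm_eq, ← hx, toCircle_apply_mk, Circle.coe_exp, mul_comm _ Complex.I,
    Complex.norm_exp_I_mul_ofReal_sub_one, norm_mul, Real.norm_eq_abs, Real.norm_eq_abs, abs_two,
    show 2 * Real.pi / 1 * (x - round x) / 2 = Real.pi * (x - round x) by ring]
  linarith

theorem fejerMultiplier_le (ω : UnitAddCircle) (M : ℕ) (k : ℤ) {d : ℝ} (hd : 0 < d)
    (hk : d ≤ M * ‖k • ω‖) : fejerMultiplier ω M k ≤ 1 / (4 * d ^ 2) := by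
  have hgeom : ‖∑ j ∈ Finset.range M, (fourier k ω : ℂ) ^ j‖ * ‖(fourier k ω : ℂ) - 1‖ ≤ 2 := by
    rw [← norm_mul, geom_sum_mul]
    refine (norm_sub_le _ _).trans_eq ?_
    rw [norm_pow, norm_fourier_apply, one_pow, norm_one, one_add_one_eq_two]
  have hsep : 4 * ‖k • ω‖ ≤ ‖(fourier k ω : ℂ) - 1‖ := by
    rw [fourier_apply]
    exact four_mul_norm_le_norm_toCircle_sub_one _
  have hM : (0 : ℝ) < M := pos_of_mul_pos_left (hd.trans_le hk) (norm_nonneg _)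
  have hle : ‖∑ j ∈ Finset.range M, (fourier k ω : ℂ) ^ j‖ / M ≤ 1 / (2 * d) := by
    rw [div_le_div_iff₀ hM (by positivity)]
    calc ‖∑ j ∈ Finset.range M, (fourier k ω : ℂ) ^ j‖ * (2 * d)
        ≤ ‖∑ j ∈ Finset.range M, (fourier k ω : ℂ) ^ j‖ * (2 * (M * ‖k • ω‖)) := by gcongr
      _ = ‖∑ j ∈ Finset.range M, (fourier k ω : ℂ) ^ j‖ * (4 * ‖k • ω‖) * M / 2 := by ring
      _ ≤ 2 * M / 2 := by gcongr; exact (mul_le_mul_of_nonneg_left hsep (norm_nonneg _)).trans hgeom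
      _ = 1 * M := by ring
  calc fejerMultiplier ω M k ≤ (1 / (2 * d)) ^ 2 := by unfold fejerMultiplier; gcongr
    _ = 1 / (4 * d ^ 2) := by ring

theorem memLp_comp_add_right {E : Type*} [NormedAddCommGroup E] {p : ENNReal}
    {f : UnitAddCircle → E} (hf : MemLp f p) (t : UnitAddCircle) :
    MemLp (fun x => f (x + t)) p :=
  hf.comp_measurePreserving (measurePreserving_add_right volume t)

theorem memLp_fejerAverage {u : UnitAddCircle → ℝ} {p : ENNReal} (hu : MemLp u p)
    (ω : UnitAddCircle) (M : ℕ) : MemLp (fejerAverage u ω M) p :=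
  memLp_finsetSum _ fun _ _ => (memLp_comp_add_right hu _).const_mul _

theorem fourierCoeff_fejerAverage {u : UnitAddCircle → ℝ} (hu : Integrable u)
    (ω : UnitAddCircle) (M : ℕ) (k : ℤ) :
    fourierCoeff (fun x => (fejerAverage u ω M x : ℂ)) k =
      fejerMultiplier ω M k * fourierCoeff (fun x => (u x : ℂ)) k := by
  have hexpand : (fun x => (fejerAverage u ω M x : ℂ)) = fun x => ((M : ℂ) ^ 2)⁻¹ *
      (∑ p ∈ Finset.range M ×ˢ Finset.range M,
        fun y => (u (y + ((p.1 : ℤ) - p.2) • ω) : ℂ)) x := by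
    ext x
    rw [fejerAverage_eq_sum_sum, Finset.sum_apply, Finset.sum_product]
    push_cast
    rfl
  have hint (m : ℤ) : Integrable (fun x => (u (x + m • ω) : ℂ)) haarAddCircle := by
    rw [haarAddCircle_eq_volume]
    exact (hu.comp_add_right _).ofReal
  have hsq : ∑ p ∈ Finset.range M ×ˢ Finset.range M, (fourier k (((p.1 : ℤ) - p.2) • ω) : ℂ) =
      (‖∑ j ∈ Finset.range M, (fourier k ω : ℂ) ^ j‖ : ℂ) ^ 2 := by
    rw [← Complex.mul_conj', map_sum, Finset.sum_mul_sum, Finset.sum_product]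
    refine Finset.sum_congr rfl fun i _ => Finset.sum_congr rfl fun j _ => ?_
    rw [sub_eq_add_neg, add_zsmul, fourier_add_apply, fourier_zsmul_apply, fourier_zsmul_apply,
      zpow_natCast, zpow_neg, zpow_natCast, map_pow, ← inv_pow,
      Complex.inv_eq_conj (norm_fourier_apply k ω)]
  rw [hexpand, fourierCoeff.const_mul, fourierCoeff.sum _ _ fun p _ => hint _, Finset.sum_apply]
  simp only [fourierCoeff_comp_add_right (fun x => (u x : ℂ))]
  rw [← Finset.sum_mul, hsq, fejerMultiplier]
  push_cast
  ring

end FejerMultiplier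

section HalfEnergy

/-- `E` bounds the homogeneous `H^{1/2}` energy `∑ₖ |k| ‖f̂(k)‖²` of `f`. -/
def HalfEnergyLE (f : UnitAddCircle → ℂ) (E : ℝ) : Prop :=
  ∀ S : Finset ℤ, ∑ k ∈ S, |(k : ℝ)| * ‖fourierCoeff f k‖ ^ 2 ≤ E

theorem HalfEnergyLE.nonneg {f : UnitAddCircle → ℂ} {E : ℝ} (h : HalfEnergyLE f E) : 0 ≤ E := by
  simpa using h ∅

theorem HalfEnergyLE.mono {f : UnitAddCircle → ℂ} {E E' : ℝ} (h : HalfEnergyLE f E)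
    (hE : E ≤ E') : HalfEnergyLE f E' :=
  fun S => (h S).trans hE

theorem HalfEnergyLE.of_norm_le {f g : UnitAddCircle → ℂ} {E : ℝ} (hf : HalfEnergyLE f E)
    (hfg : ∀ k, ‖fourierCoeff g k‖ ≤ ‖fourierCoeff f k‖) : HalfEnergyLE g E :=
  fun S => (Finset.sum_le_sum fun k _ => by gcongr; exact hfg k).trans (hf S)

theorem HalfEnergyLE.sum_sq_norm_le_div {f : UnitAddCircle → ℂ} {E L : ℝ}
    (hf : HalfEnergyLE f E) (hL : 0 < L) {S : Finset ℤ} (hS : ∀ k ∈ S, L ≤ |(k : ℝ)|) :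
    ∑ k ∈ S, ‖fourierCoeff f k‖ ^ 2 ≤ E / L := by
  rw [le_div_iff₀' hL, Finset.mul_sum]
  exact (Finset.sum_le_sum fun k hk => by gcongr; exact hS k hk).trans (hf S)

theorem HalfEnergyLE.sq_sum_mul_norm_le {f : UnitAddCircle → ℂ} {E : ℝ} (hf : HalfEnergyLE f E)
    {S : Finset ℤ} (hS : 0 ∉ S) (d : ℤ → ℝ) :
    (∑ k ∈ S, d k * ‖fourierCoeff f k‖) ^ 2 ≤ (∑ k ∈ S, d k ^ 2 / |(k : ℝ)|) * E := by
  have hsplit : ∑ k ∈ S, d k * ‖fourierCoeff f k‖ =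
      ∑ k ∈ S, d k / √|(k : ℝ)| * (√|(k : ℝ)| * ‖fourierCoeff f k‖) := by
    refine Finset.sum_congr rfl fun k hk => ?_
    have hk0 : (k : ℝ) ≠ 0 := Int.cast_ne_zero.2 fun h => hS (h ▸ hk)
    have : √|(k : ℝ)| ≠ 0 := by positivity
    field_simp
  rw [hsplit]
  refine (Finset.sum_mul_sq_le_sq_mul_sq _ _ _).trans ?_
  simp only [div_pow, mul_pow, Real.sq_sqrt (abs_nonneg _)]
  gcongr
  exact hf S

theorem halfEnergyLE_fejerAverage {u : UnitAddCircle → ℝ} {E : ℝ} (hu : Integrable u)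
    (h : HalfEnergyLE (fun x => (u x : ℂ)) E) (ω : UnitAddCircle) (M : ℕ) :
    HalfEnergyLE (fun x => (fejerAverage u ω M x : ℂ)) E :=
  h.of_norm_le fun k => by
    rw [fourierCoeff_fejerAverage hu, norm_mul, Complex.norm_real,
      Real.norm_of_nonneg (fejerMultiplier_nonneg ω M k)]
    exact mul_le_of_le_one_left (norm_nonneg _) (fejerMultiplier_le_one ω M k)

end HalfEnergy

section LargeScale

theorem sum_fejerMultiplier_block_le {ω : UnitAddCircle} {M R : ℕ} {c : ℝ} (hc : 0 < c)
    (hR : R ≠ 0) (hsep : ∀ k : ℤ, 0 < |k| → |k| ≤ R → c * R ≤ M * ‖k • ω‖) (a : ℤ) :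
    ∑ i ∈ Finset.range R, fejerMultiplier ω M (a + i) ≤ 1 + 1 / c ^ 2 := by
  have hR1 : (1 : ℝ) ≤ R := by exact_mod_cast Nat.one_le_iff_ne_zero.2 hR
  rw [← Finset.sum_filter_add_sum_filter_not _
    (fun i : ℕ => M * ‖(a + i : ℤ) • ω‖ < c * R / 2)]
  refine add_le_add ?_ ?_
  · have hcard : (Finset.filter (fun i : ℕ => M * ‖(a + i : ℤ) • ω‖ < c * R / 2)
        (Finset.range R)).card ≤ 1 := by
      refine Finset.card_le_one.2 fun i hi j hj => ?_
      simp only [Finset.mem_filter, Finset.mem_range] at hi hj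
      by_contra hne
      have hij := hsep ((a + i : ℤ) - (a + j : ℤ)) (abs_pos.2 (by omega))
        (abs_le.2 ⟨by omega, by omega⟩)
      rw [sub_zsmul, ← sub_eq_add_neg] at hij
      have htri := mul_le_mul_of_nonneg_left
        (norm_sub_le ((a + i : ℤ) • ω) ((a + j : ℤ) • ω)) M.cast_nonneg (α := ℝ)
      linarith [hi.2, hj.2]
    refine (Finset.sum_le_card_nsmul _ _ 1 fun i _ => fejerMultiplier_le_one ω M _).trans ?_
    simpa using hcard
  · have hfar : ∀ i ∈ Finset.filter (fun i : ℕ => ¬ M * ‖(a + i : ℤ) • ω‖ < c * R / 2)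
        (Finset.range R), fejerMultiplier ω M (a + i) ≤ 1 / (c * R) ^ 2 := fun i hi =>
      (fejerMultiplier_le ω M _ (by positivity) (not_lt.1 (Finset.mem_filter.1 hi).2)).trans_eq
        (by ring)
    calc _ ≤ R • (1 / (c * R) ^ 2) := by
          refine (Finset.sum_le_card_nsmul _ _ _ hfar).trans ?_
          exact nsmul_le_nsmul_left (by positivity)
            ((Finset.card_filter_le _ _).trans_eq (Finset.card_range R))
      _ = 1 / c ^ 2 / R := by
          rw [nsmul_eq_mul]
          field_simp
      _ ≤ 1 / c ^ 2 := div_le_self (by positivity) hR1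

theorem sum_range_succ_div_le {d : ℕ → ℝ} (hd : ∀ k, 0 ≤ d k) {R : ℕ} (hR : R ≠ 0) {T : ℝ}
    (hle : ∀ k, 1 ≤ k → k ≤ R → d k ≤ T / R ^ 2) :
    ∑ k ∈ Finset.range (R + 1), d k / k ≤ T / R := by
  rw [Finset.sum_range_succ']
  calc _ ≤ R • (T / R ^ 2) + 0 := by
        gcongr
        · refine (Finset.sum_le_card_nsmul _ _ (T / R ^ 2) fun k hk => ?_).trans_eq (by simp)
          exact (div_le_self (hd _) (by simp)).trans
            (hle _ (by omega) (Finset.mem_range.1 hk))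
        · simp
    _ = T / R := by
        rw [nsmul_eq_mul]
        field_simp
        ring

theorem sum_range_div_le_of_block_sum_le {d : ℕ → ℝ} (hd : ∀ k, 0 ≤ d k) {R : ℕ} (hR : R ≠ 0)
    {T : ℝ} (hblock : ∀ a, ∑ i ∈ Finset.range R, d (a + i) ≤ T)
    (hfirst : ∀ k, 1 ≤ k → k ≤ R → d k ≤ T / R ^ 2) (K : ℕ) :
    ∑ k ∈ Finset.range (K + 1), d k / k ≤ T / R * (2 + Real.log K) := by
  have hT : 0 ≤ T := (Finset.sum_nonneg fun i _ => hd _).trans (hblock 0)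
  have hblocks (N : ℕ) : ∑ k ∈ Finset.range ((N + 1) * R + 1), d k / k ≤
      T / R * (1 + harmonic N) := by
    induction N with
    | zero => simpa using sum_range_succ_div_le hd hR hfirst
    | succ N ih =>
      have hnext : ∑ i ∈ Finset.range R, d ((N + 1) * R + 1 + i) / ((N + 1) * R + 1 + i : ℕ) ≤
          T / ((N + 1) * R) := by
        refine le_trans ?_ (div_le_div_of_nonneg_right (hblock ((N + 1) * R + 1)) (by positivity))
        rw [Finset.sum_div]
        gcongr with i
        · exact hd _
        · push_cast
          linarith [(Nat.cast_nonneg i : (0 : ℝ) ≤ i)]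
      rw [show (N + 1 + 1) * R + 1 = (N + 1) * R + 1 + R by ring, Finset.sum_range_add,
        harmonic_succ]
      refine (add_le_add ih hnext).trans_eq ?_
      push_cast
      field_simp
      ring
  calc ∑ k ∈ Finset.range (K + 1), d k / k
      ≤ ∑ k ∈ Finset.range ((K + 1) * R + 1), d k / k :=
        Finset.sum_le_sum_of_subset_of_nonneg
          (Finset.range_mono (by nlinarith [Nat.one_le_iff_ne_zero.2 hR]))
          fun k _ _ => div_nonneg (hd k) k.cast_nonneg
    _ ≤ T / R * (1 + harmonic K) := hblocks K
    _ ≤ T / R * (2 + Real.log K) := by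
        refine mul_le_mul_of_nonneg_left ?_ (by positivity)
        linarith [harmonic_le_one_add_log K]

theorem sum_fejerMultiplier_div_abs_le {ω : UnitAddCircle} {M R : ℕ} {c : ℝ} (hc : 0 < c)
    (hR : R ≠ 0) (hsep : ∀ k : ℤ, 0 < |k| → |k| ≤ R → c * R ≤ M * ‖k • ω‖) (K : ℕ) :
    ∑ k ∈ Finset.Icc (-(K : ℤ)) K, fejerMultiplier ω M k / |(k : ℝ)| ≤
      2 * ((1 + 1 / c ^ 2) / R * (2 + Real.log K)) := by
  have heven : Function.Even fun k : ℤ => fejerMultiplier ω M k / |(k : ℝ)| := fun k => by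
    simp [fejerMultiplier_neg]
  have hfirst (k : ℕ) (hk1 : 1 ≤ k) (hkR : k ≤ R) :
      fejerMultiplier ω M k ≤ (1 + 1 / c ^ 2) / R ^ 2 := by
    have hk := hsep k (by positivity) (by simpa using hkR)
    calc fejerMultiplier ω M k ≤ 1 / (4 * (c * R) ^ 2) :=
          fejerMultiplier_le ω M k (by positivity) hk
      _ = 1 / 4 * (1 / c ^ 2) / R ^ 2 := by ring
      _ ≤ (1 + 1 / c ^ 2) / R ^ 2 := by
          gcongr
          linarith [show 0 ≤ 1 / c ^ 2 by positivity]
  rw [Finset.sum_Icc_of_even_eq_range heven, two_nsmul, ← two_mul, Int.cast_zero, abs_zero,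
    div_zero, sub_zero]
  simpa using sum_range_div_le_of_block_sum_le (fun k => fejerMultiplier_nonneg ω M k) hR
    (fun a => by simpa using sum_fejerMultiplier_block_le hc hR hsep a) hfirst K

theorem HalfEnergyLE.sum_norm_fourierCoeff_fejerAverage_le {u : UnitAddCircle → ℝ} {E : ℝ}
    (hu : Integrable u) (hE : HalfEnergyLE (fun x => (u x : ℂ)) E) {ω : UnitAddCircle}
    {M R K : ℕ} {c l : ℝ} (hc : 0 < c) (hR : R ≠ 0) (hl : 0 ≤ l)
    (hsep : ∀ k : ℤ, 0 < |k| → |k| ≤ R → c * R ≤ M * ‖k • ω‖)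
    (hlR : 8 * E * ((1 + 1 / c ^ 2) / R * (2 + Real.log K)) ≤ l ^ 2) :
    ∑ k ∈ (Finset.Icc (-(K : ℤ)) K).erase 0,
      ‖fourierCoeff (fun x => (fejerAverage u ω M x : ℂ)) k‖ ≤ l / 2 := by
  have hE0 := hE.nonneg
  refine abs_le_of_sq_le_sq' ?_ (by positivity) |>.2
  simp only [fourierCoeff_fejerAverage hu, norm_mul, Complex.norm_real,
    Real.norm_of_nonneg (fejerMultiplier_nonneg ω M _)]
  calc _ ≤ (∑ k ∈ (Finset.Icc (-(K : ℤ)) K).erase 0, fejerMultiplier ω M k ^ 2 / |(k : ℝ)|) * E :=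
        hE.sq_sum_mul_norm_le (Finset.notMem_erase 0 _) _
    _ ≤ (∑ k ∈ Finset.Icc (-(K : ℤ)) K, fejerMultiplier ω M k / |(k : ℝ)|) * E := by
        rw [← Finset.sum_erase (Finset.Icc (-(K : ℤ)) K) (a := 0)
          (f := fun k => fejerMultiplier ω M k / |(k : ℝ)|) (by simp)]
        gcongr with k
        exact pow_le_of_le_one (fejerMultiplier_nonneg ω M k) (fejerMultiplier_le_one ω M k)
          two_ne_zero
    _ ≤ 2 * ((1 + 1 / c ^ 2) / R * (2 + Real.log K)) * E := by
        gcongr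
        exact sum_fejerMultiplier_div_abs_le hc hR hsep K
    _ ≤ (l / 2) ^ 2 := by linarith

theorem fourierCoeff_fejerAverage_zero {u : UnitAddCircle → ℝ} (hu : Integrable u)
    (ω : UnitAddCircle) {M : ℕ} (hM : M ≠ 0) :
    fourierCoeff (fun x => (fejerAverage u ω M x : ℂ)) 0 = ((∫ y, u y : ℝ) : ℂ) := by
  rw [fourierCoeff_fejerAverage hu, fejerMultiplier_zero ω hM, Complex.ofReal_one, one_mul,
    fourierCoeff_ofReal_zero]

theorem measureReal_lt_abs_fejerAverage_sub_integral_le {u : UnitAddCircle → ℝ} {E : ℝ}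
    (hu : MemLp u 2) (hE : HalfEnergyLE (fun x => (u x : ℂ)) E) {ω : UnitAddCircle} {M R K : ℕ}
    {c l : ℝ} (hc : 0 < c) (hM : M ≠ 0) (hR : R ≠ 0) (hK : K ≠ 0) (hl : 0 < l)
    (hsep : ∀ k : ℤ, 0 < |k| → |k| ≤ R → c * R ≤ M * ‖k • ω‖)
    (hlR : 8 * E * ((1 + 1 / c ^ 2) / R * (2 + Real.log K)) ≤ l ^ 2) :
    volume.real {x | l < |fejerAverage u ω M x - ∫ y, u y|} ≤ 4 * (E / K) / l ^ 2 := by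
  have hint : Integrable u := hu.integrable one_le_two
  have hdev := measureReal_lt_norm_sub_fourierCoeff_zero_le (memLp_fejerAverage hu ω M).ofReal
    (S := Finset.Icc (-(K : ℤ)) K) (Finset.mem_Icc.2 ⟨by omega, by omega⟩) hl
    (hE.sum_norm_fourierCoeff_fejerAverage_le hint hc hR hl.le hsep hlR) fun T hT =>
      (halfEnergyLE_fejerAverage hint hE ω M).sum_sq_norm_le_div (L := K) (by positivity)
        fun k hk => ?_
  · simpa only [fourierCoeff_fejerAverage_zero hint ω hM, RCLike.ofReal_eq_complex_ofReal,
      ← Complex.ofReal_sub, Complex.norm_real, Real.norm_eq_abs] using hdev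
  · have := Finset.disjoint_right.1 hT hk
    rw [Finset.mem_Icc, ← abs_le, not_le] at this
    exact_mod_cast this.le

end LargeScale

section Diophantine

theorem mul_le_mul_norm_zsmul_of_diophantine {ω : UnitAddCircle} {M R : ℕ} {A c : ℝ} (hA : 0 ≤ A)
    (hc : 0 ≤ c) (hR : R ≠ 0) (hRM : (R : ℝ) ^ (1 + A) ≤ M)
    (hω : ∀ k : ℤ, 0 < |k| → |k| ≤ (M : ℤ) → c * |(k : ℝ)| ^ (-A) < ‖k • ω‖) (k : ℤ)
    (hk0 : 0 < |k|) (hkR : |k| ≤ R) : c * R ≤ M * ‖k • ω‖ := by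
  have hR0 : (0 : ℝ) < R := by positivity
  have hR1 : (1 : ℝ) ≤ R := by exact_mod_cast Nat.one_le_iff_ne_zero.2 hR
  have hle : (R : ℝ) ≤ M := (Real.self_le_rpow_of_one_le hR1 (by linarith)).trans hRM
  have hk0' : (0 : ℝ) < |(k : ℝ)| := by exact_mod_cast hk0
  have hkR' : |(k : ℝ)| ≤ R := by exact_mod_cast hkR
  calc c * R = c * R ^ (-A) * R ^ (1 + A) := by
        rw [mul_assoc, ← Real.rpow_add hR0, neg_add_cancel_comm_assoc, Real.rpow_one]
    _ ≤ c * |(k : ℝ)| ^ (-A) * M := by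
        gcongr ?_ * ?_
        exact mul_le_mul_of_nonneg_left
          (Real.rpow_le_rpow_of_nonpos hk0' hkR' (neg_nonpos.2 hA)) hc
    _ ≤ ‖k • ω‖ * M := by
        gcongr
        exact (hω k hk0 (hkR.trans (by exact_mod_cast hle))).le
    _ = M * ‖k • ω‖ := mul_comm _ _

theorem eventually_mul_add_le_sq (a b : ℝ) : ∀ᶠ X : ℝ in atTop, a * (b + X) ≤ X ^ 2 := by
  filter_upwards [eventually_ge_atTop (|b| + 2 * |a|), eventually_ge_atTop |b|] with X hX hb
  have hab : a * (b + X) ≤ |a| * (2 * X) :=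
    (le_abs_self _).trans <| by
      rw [abs_mul]
      gcongr
      exact (abs_add_le b X).trans (by rw [abs_of_nonneg ((abs_nonneg b).trans hb)]; linarith)
  nlinarith [abs_nonneg a, abs_nonneg b]

theorem eventually_mul_sq_mul_exp_neg_lt (a : ℝ) :
    ∀ᶠ X : ℝ in atTop, a * X ^ 2 * Real.exp (-X) < Real.exp (-(1 / 2 * X)) := by
  have hlim := ((Real.tendsto_pow_mul_exp_neg_atTop_nhds_zero 2).comp
    (tendsto_id.const_mul_atTop (half_pos (zero_lt_one' ℝ)))).const_mul (4 * a)
  rw [mul_zero] at hlim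
  filter_upwards [hlim.eventually (gt_mem_nhds (zero_lt_one' ℝ))] with X hX
  have hexp : Real.exp (-X) = Real.exp (-(1 / 2 * X)) * Real.exp (-(1 / 2 * X)) := by
    rw [← Real.exp_add]
    congr 1
    ring
  calc a * X ^ 2 * Real.exp (-X)
      = 4 * a * ((1 / 2 * X) ^ 2 * Real.exp (-(1 / 2 * X))) * Real.exp (-(1 / 2 * X)) := by
        rw [hexp]
        ring
    _ < 1 * Real.exp (-(1 / 2 * X)) := by gcongr; exact hX
    _ = Real.exp (-(1 / 2 * X)) := one_mul _

theorem log_natCeil_exp_le {X : ℝ} (hX : 0 ≤ X) : Real.log ⌈Real.exp X⌉₊ ≤ X + 1 := by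
  rw [Real.log_le_iff_le_exp (by exact_mod_cast Nat.ceil_pos.2 (Real.exp_pos X)), Real.exp_add]
  have hceil := Nat.ceil_lt_add_one (Real.exp_pos X).le
  have h1 : 1 ≤ Real.exp X := Real.one_le_exp hX
  have h2 : 2 ≤ Real.exp 1 := by linarith [Real.add_one_le_exp (1 : ℝ)]
  nlinarith

theorem half_le_natFloor {x : ℝ} (hx : 1 ≤ x) : x / 2 ≤ (⌊x⌋₊ : ℝ) := by
  have h1 : (1 : ℝ) ≤ (⌊x⌋₊ : ℝ) := by exact_mod_cast (Nat.one_le_floor_iff x).2 hx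
  linarith [Nat.lt_floor_add_one x]

/- The Diophantine condition up to `M` separates the multiples `k • ω` for `k` in a block of length
`⌊X⁴⌋`; the energy alone handles the frequencies beyond `⌈exp X⌉`. -/
theorem measureReal_inv_lt_abs_fejerAverage_sub_integral_lt {u : UnitAddCircle → ℝ} {E : ℝ}
    (hu : MemLp u 2) (hE : HalfEnergyLE (fun x => (u x : ℂ)) E) {ω : UnitAddCircle} {M : ℕ}
    {A c X : ℝ} (hA : 0 ≤ A) (hc : 0 < c) (hX : 1 ≤ X) (hXM : X ^ (4 * (1 + A)) ≤ M)
    (hω : ∀ k : ℤ, 0 < |k| → |k| ≤ (M : ℤ) → c * |(k : ℝ)| ^ (-A) < ‖k • ω‖)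
    (hX_sq : 16 * E * (1 + 1 / c ^ 2) * (3 + X) ≤ X ^ 2)
    (hX_exp : 4 * E * X ^ 2 * Real.exp (-X) < Real.exp (-(1 / 2 * X))) :
    volume.real {x | X⁻¹ < |fejerAverage u ω M x - ∫ y, u y|} < Real.exp (-(1 / 2 * X)) := by
  have hE0 := hE.nonneg
  have hX4 : 1 ≤ X ^ 4 := one_le_pow₀ hX
  have hR : ⌊X ^ 4⌋₊ ≠ 0 := (Nat.floor_pos.2 hX4).ne'
  have hRM : (⌊X ^ 4⌋₊ : ℝ) ^ (1 + A) ≤ M := by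
    refine le_trans ?_ hXM
    rw [Real.rpow_mul (by positivity), Real.rpow_ofNat]
    exact Real.rpow_le_rpow (by positivity) (Nat.floor_le (by positivity)) (by positivity)
  have hM : M ≠ 0 := by
    rintro rfl
    exact (Real.rpow_pos_of_pos (zero_lt_one.trans_le hX) _).not_ge (by simpa using hXM)
  have hsmall : 8 * E * ((1 + 1 / c ^ 2) / ⌊X ^ 4⌋₊ * (2 + Real.log ⌈Real.exp X⌉₊)) ≤
      X⁻¹ ^ 2 := by
    calc _ ≤ 8 * E * ((1 + 1 / c ^ 2) / (X ^ 4 / 2) * (2 + (X + 1))) := by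
          have := Real.log_natCast_nonneg ⌈Real.exp X⌉₊
          gcongr
          · exact half_le_natFloor hX4
          · exact log_natCeil_exp_le (by positivity)
      _ = 16 * E * (1 + 1 / c ^ 2) * (3 + X) / X ^ 4 := by ring
      _ ≤ X ^ 2 / X ^ 4 := by gcongr
      _ = X⁻¹ ^ 2 := by field_simp
  calc _ ≤ 4 * (E / ⌈Real.exp X⌉₊) / X⁻¹ ^ 2 :=
        measureReal_lt_abs_fejerAverage_sub_integral_le hu hE hc hM hR
          (Nat.ceil_pos.2 (Real.exp_pos X)).ne' (by positivity)
          (mul_le_mul_norm_zsmul_of_diophantine hA hc.le hR hRM hω) hsmall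
    _ ≤ 4 * (E / Real.exp X) / X⁻¹ ^ 2 := by gcongr; exact Nat.le_ceil _
    _ = 4 * E * X ^ 2 * Real.exp (-X) := by rw [Real.exp_neg]; field_simp
    _ < Real.exp (-(1 / 2 * X)) := hX_exp

theorem exists_forall_ge_measureReal_lt_abs_fejerAverage_sub_integral_lt {A c : ℝ} (hA : 0 ≤ A)
    (hc : 0 < c) (E : ℝ) :
    ∃ M₀ : ℕ, ∀ u : UnitAddCircle → ℝ, MemLp u 2 → HalfEnergyLE (fun x => (u x : ℂ)) E →
      ∀ (ω : UnitAddCircle) (M : ℕ), M₀ ≤ M →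
        (∀ k : ℤ, 0 < |k| → |k| ≤ (M : ℤ) → c * |(k : ℝ)| ^ (-A) < ‖k • ω‖) →
        volume.real {x | (M : ℝ) ^ (-(1 / (4 * (1 + A)))) <
            |fejerAverage u ω M x - ∫ y, u y|} <
          Real.exp (-(1 / 2 * (M : ℝ) ^ (1 / (4 * (1 + A))))) := by
  have hlim : Tendsto (fun M : ℕ => (M : ℝ) ^ (1 / (4 * (1 + A)))) atTop atTop :=
    (tendsto_rpow_atTop (by positivity)).comp tendsto_natCast_atTop_atTop
  obtain ⟨M₀, hM₀⟩ := eventually_atTop.1 (hlim.eventually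
    (((eventually_mul_add_le_sq (16 * E * (1 + 1 / c ^ 2)) 3).and
      (eventually_mul_sq_mul_exp_neg_lt (4 * E))).and (eventually_ge_atTop 1)))
  refine ⟨M₀, fun u hu hE ω M hM hω => ?_⟩
  obtain ⟨⟨hX_sq, hX_exp⟩, hX⟩ := hM₀ M hM
  rw [Real.rpow_neg M.cast_nonneg]
  refine measureReal_inv_lt_abs_fejerAverage_sub_integral_lt hu hE hA hc hX ?_ hω hX_sq hX_exp
  rw [← Real.rpow_mul M.cast_nonneg, one_div, inv_mul_cancel₀ (by positivity), Real.rpow_one]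

end Diophantine

section Translations

theorem norm_fourier_coe_sub_one_le (k : ℤ) (s : ℝ) :
    ‖(fourier k (s : UnitAddCircle) : ℂ) - 1‖ ≤ 2 * Real.pi * |(k : ℝ)| * |s| := by
  have h : (fourier k (s : UnitAddCircle) : ℂ) =
      Complex.exp (Complex.I * ((2 * Real.pi * k * s : ℝ) : ℂ)) := by
    rw [fourier_coe_apply]
    push_cast
    ring_nf
  rw [h]
  refine Real.norm_exp_I_mul_ofReal_sub_one_le.trans_eq ?_
  simp only [Real.norm_eq_abs, abs_mul, abs_two, abs_of_pos Real.pi_pos]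

theorem hasSum_sq_norm_fourier_sub_one_mul {f : UnitAddCircle → ℂ} (hf : MemLp f 2)
    (t : UnitAddCircle) :
    HasSum (fun k => (‖(fourier k t : ℂ) - 1‖ * ‖fourierCoeff f k‖) ^ 2)
      (∫ x, ‖f (x + t) - f x‖ ^ 2) := by
  have hft := memLp_comp_add_right hf t
  convert hasSum_sq_fourierCoeff_of_memLp (hft.sub hf) using 3 with k
  swap
  · rfl
  rw [← norm_mul]
  have h := fourierCoeff_sub (hft.integrable one_le_two) (hf.integrable one_le_two) k
  rw [fourierCoeff_comp_add_right] at h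
  rw [sub_one_mul, ← h]
  rfl

/-- The energy `∑ₖ min ((k/N)², 1) ‖f̂(k)‖²`, which up to a constant bounds the squared `L²`
distance from `f` to its translates by at most `1/N`. -/
noncomputable def translationEnergy (f : UnitAddCircle → ℂ) (N : ℝ) : ℝ :=
  ∑' k : ℤ, min ((k / N) ^ 2) 1 * ‖fourierCoeff f k‖ ^ 2

theorem summable_translationEnergy {f : UnitAddCircle → ℂ} (hf : MemLp f 2) (N : ℝ) :
    Summable fun k : ℤ => min ((k / N) ^ 2) 1 * ‖fourierCoeff f k‖ ^ 2 :=
  (hasSum_sq_fourierCoeff_of_memLp hf).summable.of_nonneg_of_le (fun k => by positivity)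
    fun k => mul_le_of_le_one_left (by positivity) (min_le_right _ _)

theorem integral_sq_norm_translate_sub_le {f : UnitAddCircle → ℂ} (hf : MemLp f 2) {N s : ℝ}
    (hs : |s| ≤ 1 / N) :
    ∫ x, ‖f (x + (s : UnitAddCircle)) - f x‖ ^ 2 ≤ 40 * translationEnergy f N := by
  have hN : 0 ≤ N := one_div_nonneg.1 ((abs_nonneg s).trans hs)
  rw [translationEnergy, ← tsum_mul_left]
  refine hasSum_le (fun k => ?_) (hasSum_sq_norm_fourier_sub_one_mul hf s)
    ((summable_translationEnergy hf N).mul_left 40).hasSum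
  rw [mul_pow, ← mul_assoc]
  gcongr
  rw [mul_min_of_nonneg _ _ (by norm_num)]
  refine le_min ?_ ?_
  · calc _ ≤ (2 * Real.pi * |(k : ℝ)| * (1 / N)) ^ 2 := by
          gcongr
          exact (norm_fourier_coe_sub_one_le k s).trans (by gcongr)
      _ = 4 * Real.pi ^ 2 * (k / N) ^ 2 := by
          rw [← sq_abs (k / N : ℝ), abs_div, abs_of_nonneg hN]
          ring
      _ ≤ 40 * (k / N) ^ 2 := by
          gcongr
          nlinarith [Real.pi_pos, Real.pi_lt_d2]
  · calc _ ≤ (1 + 1 : ℝ) ^ 2 := by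
          gcongr
          refine (norm_sub_le _ _).trans_eq ?_
          rw [norm_fourier_apply, norm_one]
      _ ≤ 40 * 1 := by norm_num

theorem sum_two_pow_mul_min_le {k : ℝ} (hk : 0 ≤ k) (J : ℕ) :
    ∑ j ∈ Finset.range J, 2 ^ j * min ((k / 2 ^ j) ^ 2) 1 ≤ 6 * k := by
  suffices h : ∑ j ∈ Finset.range J, 2 ^ j * min ((k / 2 ^ j) ^ 2) 1 ≤
      6 * k * 2 ^ J / (2 ^ J + k) by
    refine h.trans ((div_le_iff₀ (by positivity)).2 ?_)
    nlinarith [mul_nonneg hk hk]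
  induction J with
  | zero => simpa using by positivity
  | succ J ih =>
    rw [Finset.sum_range_succ, pow_succ' 2 J]
    have ha : (0 : ℝ) < 2 ^ J := by positivity
    generalize (2 : ℝ) ^ J = a at ih ha ⊢
    have hstep : 6 * k * (2 * a) / (2 * a + k) - 6 * k * a / (a + k) =
        a * (6 * k ^ 2 / ((2 * a + k) * (a + k))) := by
      field_simp
      ring
    have hmin : min ((k / a) ^ 2) 1 ≤ 6 * k ^ 2 / ((2 * a + k) * (a + k)) := by
      rw [le_div_iff₀ (by positivity)]
      rcases le_total k a with hka | hka
      · calc _ ≤ (k / a) ^ 2 * ((2 * a + a) * (a + a)) := by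
              gcongr
              exact min_le_left _ _
          _ = 6 * k ^ 2 := by
              field_simp
              ring
      · calc _ ≤ 1 * ((2 * k + k) * (k + k)) := by
              gcongr
              exact min_le_right _ _
          _ = 6 * k ^ 2 := by ring
    linarith [mul_le_mul_of_nonneg_left hmin ha.le]

theorem HalfEnergyLE.exists_two_pow_mul_translationEnergy_le {f : UnitAddCircle → ℂ} {E : ℝ}
    (hf : MemLp f 2) (hE : HalfEnergyLE f E) {J : ℕ} (hJ : J ≠ 0) :
    ∃ j < J, 2 ^ j * translationEnergy f (2 ^ j) ≤ 6 * E / J := by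
  have hsum : ∑ j ∈ Finset.range J, 2 ^ j * translationEnergy f (2 ^ j) ≤ 6 * E := by
    simp only [translationEnergy, ← tsum_mul_left]
    rw [← Summable.tsum_finsetSum fun j _ => (summable_translationEnergy hf _).mul_left _]
    refine tsum_le_of_sum_le' (by linarith [hE.nonneg]) fun S => ?_
    calc _ ≤ ∑ k ∈ S, 6 * (|(k : ℝ)| * ‖fourierCoeff f k‖ ^ 2) := by
          refine Finset.sum_le_sum fun k _ => ?_
          simp only [← mul_assoc, ← Finset.sum_mul]
          gcongr
          simpa only [div_pow, sq_abs] using sum_two_pow_mul_min_le (abs_nonneg (k : ℝ)) J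
      _ ≤ 6 * E := by
          rw [← Finset.mul_sum]
          exact mul_le_mul_of_nonneg_left (hE S) (by norm_num)
  have hconst : 6 * E = ∑ _j ∈ Finset.range J, 6 * E / J := by
    rw [Finset.sum_const, Finset.card_range, nsmul_eq_mul]
    field_simp
  obtain ⟨j, hj, hle⟩ := Finset.exists_le_of_sum_le (Finset.nonempty_range_iff.2 hJ)
    (hsum.trans_eq hconst)
  exact ⟨j, Finset.mem_range.1 hj, hle⟩

end Translations

section NearMean

theorem measureReal_symmDiff_preimage_add_nsmul_le {G : Type*} [AddCommGroup G]
    [MeasurableSpace G] [MeasurableAdd G] (μ : Measure G) [IsFiniteMeasure μ]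
    [μ.IsAddRightInvariant] (P : Set G) (t : G) (n : ℕ) :
    μ.real (P ∆ ((· + n • t) ⁻¹' P)) ≤ n * μ.real (P ∆ ((· + t) ⁻¹' P)) := by
  induction n with
  | zero => simp
  | succ n ih =>
    have hshift : μ.real (((· + t) ⁻¹' P) ∆ ((· + (n + 1) • t) ⁻¹' P)) =
        μ.real (P ∆ ((· + n • t) ⁻¹' P)) := by
      have hpre : ((· + t) ⁻¹' P) ∆ ((· + (n + 1) • t) ⁻¹' P) =
          (· + t) ⁻¹' (P ∆ ((· + n • t) ⁻¹' P)) := by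
        rw [Set.preimage_symmDiff, Set.preimage_preimage]
        simp only [add_assoc, succ_nsmul']
      rw [hpre, measureReal_def, measure_preimage_add_right, measureReal_def]
    calc _ ≤ _ := measureReal_symmDiff_le (t := (· + t) ⁻¹' P) _
      _ ≤ (n + 1 : ℕ) * μ.real (P ∆ ((· + t) ⁻¹' P)) := by
          rw [hshift]
          push_cast
          linarith

theorem measureReal_symmDiff_pos_preimage_add_le {g : UnitAddCircle → ℝ} (hg : MemLp g 2)
    {ε : ℝ} (hε : 0 < ε) (t : UnitAddCircle) :
    volume.real ({x | 0 < g x} ∆ ((· + t) ⁻¹' {x | 0 < g x})) ≤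
      (∫ x, ‖g (x + t) - g x‖ ^ 2) / (2 * ε) ^ 2 + 2 * volume.real {x | |g x| ≤ ε} := by
  have hsub : {x | 0 < g x} ∆ ((· + t) ⁻¹' {x | 0 < g x}) ⊆
      {x | 2 * ε ≤ ‖g (x + t) - g x‖} ∪
        ({x | |g x| ≤ ε} ∪ (· + t) ⁻¹' {x | |g x| ≤ ε}) := by
    intro x hx
    simp only [Set.mem_symmDiff, Set.mem_union, Set.mem_preimage, Set.mem_ofPred_eq,
      Real.norm_eq_abs] at hx ⊢
    by_contra! h
    obtain ⟨h1, h2, h3⟩ := h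
    rw [lt_abs] at h2 h3
    rw [abs_lt] at h1
    rcases hx with hx | hx <;> rcases h2 with h2 | h2 <;> rcases h3 with h3 | h3 <;> linarith
  calc _ ≤ volume.real {x | 2 * ε ≤ ‖g (x + t) - g x‖} +
        (volume.real {x | |g x| ≤ ε} + volume.real ((· + t) ⁻¹' {x | |g x| ≤ ε})) :=
        (measureReal_mono hsub).trans <| (measureReal_union_le _ _).trans <| by
          gcongr
          exact measureReal_union_le _ _
    _ ≤ (∫ x, ‖g (x + t) - g x‖ ^ 2) / (2 * ε) ^ 2 + 2 * volume.real {x | |g x| ≤ ε} := by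
        rw [measureReal_def _ ((· + t) ⁻¹' _), measure_preimage_add_right, ← measureReal_def,
          ← two_mul]
        gcongr
        exact measureReal_le_norm_le_integral_sq_div ((memLp_comp_add_right hg t).sub hg)
          (by positivity)

theorem isProbabilityMeasure_volume_unitAddCircle :
    IsProbabilityMeasure (volume : Measure UnitAddCircle) :=
  ⟨UnitAddCircle.measure_univ⟩

theorem exists_integral_mul_comp_add_le {g h : UnitAddCircle → ℝ} (hg : Integrable g)
    (hh : Integrable h) : ∃ t, ∫ x, g x * h (x + t) ≤ (∫ x, g x) * ∫ x, h x := by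
  have := isProbabilityMeasure_volume_unitAddCircle
  have hg' : Integrable fun x => g (-x) := hg.comp_neg
  obtain ⟨t, ht⟩ := exists_le_integral (hg'.integrable_convolution (ContinuousLinearMap.mul ℝ ℝ) hh)
  rw [integral_convolution _ hg' hh, integral_neg_eq_self g] at ht
  refine ⟨t, le_trans (le_of_eq ?_) ht⟩
  rw [convolution_def, ← integral_neg_eq_self]
  simp [sub_eq_neg_add, add_comm]

theorem indicator_sub_mul_indicator_le {α : Type*} (g : α → ℝ) (S T : Set α) {b : ℝ} (hb : 0 < b)
    (x : α) :
    S.indicator g x - g x * T.indicator 1 x ≤ (b * ‖g x‖ ^ 2 + (S ∆ T).indicator 1 x / b) / 2 := by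
  have hamgm : 2 * |g x| ≤ b * ‖g x‖ ^ 2 + 1 / b := by
    have hsq : 0 ≤ (b * |g x| - 1) ^ 2 / b := by positivity
    rw [Real.norm_eq_abs, ← sub_nonneg]
    refine hsq.trans_eq ?_
    field_simp
    ring
  have hsq : 0 ≤ b * ‖g x‖ ^ 2 := by positivity
  have hlo := neg_abs_le (g x)
  have hhi := le_abs_self (g x)
  by_cases hS : x ∈ S <;> by_cases hT : x ∈ T <;>
    simp only [Set.indicator, Set.mem_symmDiff, hS, hT, not_true, not_false_eq_true, and_true,
      and_false, or_false, or_true, if_true, if_false, Pi.one_apply, zero_div] <;>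
    linarith

theorem setIntegral_le_of_measureReal_symmDiff_le {g : UnitAddCircle → ℝ} (hg : MemLp g 2)
    (hmean : ∫ x, g x = 0) {P : Set UnitAddCircle} (hP : NullMeasurableSet P) {η b : ℝ}
    (hb : 0 < b) (hη : ∀ t, volume.real (P ∆ ((· + t) ⁻¹' P)) ≤ η) :
    ∫ x in P, g x ≤ (b * (∫ x, ‖g x‖ ^ 2) + η / b) / 2 := by
  have hgi : Integrable g := hg.integrable one_le_two
  have hone {S : Set UnitAddCircle} (hS : NullMeasurableSet S) :
      Integrable (S.indicator (1 : UnitAddCircle → ℝ)) := (integrable_const 1).indicator₀ hS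
  obtain ⟨t, ht⟩ := exists_integral_mul_comp_add_le hgi (hone hP)
  rw [hmean, zero_mul] at ht
  have hPt : NullMeasurableSet ((· + t) ⁻¹' P) :=
    hP.preimage (measurePreserving_add_right volume t).quasiMeasurePreserving
  set D := P ∆ ((· + t) ⁻¹' P)
  have hDm : NullMeasurableSet D := hP.symmDiff hPt
  have hshift : Integrable fun x => g x * P.indicator 1 (x + t) :=
    hgi.mul_bdd (c := 1) (hone hPt).aestronglyMeasurable <| .of_forall fun x =>
      (norm_indicator_le_norm_self _ _).trans_eq norm_one
  have hbound : Integrable fun x => (b * ‖g x‖ ^ 2 + D.indicator 1 x / b) / 2 :=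
    (((hg.integrable_norm_pow two_ne_zero).const_mul b).add ((hone hDm).div_const b)).div_const 2
  calc ∫ x in P, g x = (∫ x, P.indicator g x - g x * P.indicator 1 (x + t)) +
        ∫ x, g x * P.indicator 1 (x + t) := by
        rw [integral_sub (hgi.indicator₀ hP) hshift, integral_indicator₀ hP, sub_add_cancel]
    _ ≤ ∫ x, (b * ‖g x‖ ^ 2 + D.indicator 1 x / b) / 2 := by
        refine (add_le_of_nonpos_right ht).trans ?_
        exact integral_mono ((hgi.indicator₀ hP).sub hshift) hbound
          fun x => indicator_sub_mul_indicator_le g P ((· + t) ⁻¹' P) hb x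
    _ ≤ (b * (∫ x, ‖g x‖ ^ 2) + η / b) / 2 := by
        rw [integral_div, integral_add ((hg.integrable_norm_pow two_ne_zero).const_mul b)
          ((hone hDm).div_const b), integral_const_mul, integral_div, integral_indicator₀ hDm]
        gcongr
        simpa only [Pi.one_apply, setIntegral_const, smul_eq_mul, mul_one] using hη t

theorem mul_one_sub_measureReal_abs_le_le {α : Type*} [MeasurableSpace α] {μ : Measure α}
    [IsProbabilityMeasure μ] {g : α → ℝ} (hg : Integrable g μ) (hmean : ∫ x, g x ∂μ = 0) {ε : ℝ}
    (hε : 0 ≤ ε) : ε * (1 - μ.real {x | |g x| ≤ ε}) ≤ 2 * ∫ x in {x | 0 < g x}, g x ∂μ := by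
  have hpos : NullMeasurableSet {x | 0 < g x} μ :=
    nullMeasurableSet_lt aemeasurable_const hg.aemeasurable
  have habs (x : α) : |g x| = 2 * {x | 0 < g x}.indicator g x - g x := by
    rw [Set.indicator_apply]
    split_ifs with h <;> rw [Set.mem_ofPred_eq] at h
    · rw [abs_of_pos h]
      ring
    · rw [abs_of_nonpos (not_lt.1 h)]
      ring
  calc ε * (1 - μ.real {x | |g x| ≤ ε}) ≤ ε * μ.real {x | ε ≤ |g x|} := by
        gcongr
        rw [sub_le_iff_le_add', ← probReal_univ (μ := μ)]
        refine (measureReal_mono fun x _ => ?_).trans (measureReal_union_le _ _)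
        exact le_total |g x| ε
    _ ≤ ∫ x, |g x| ∂μ :=
        mul_meas_ge_le_integral_of_nonneg (.of_forall fun x => abs_nonneg _) hg.abs ε
    _ = 2 * ∫ x in {x | 0 < g x}, g x ∂μ := by
        simp only [habs]
        rw [integral_sub ((hg.indicator₀ hpos).const_mul 2) hg, hmean, sub_zero,
          integral_const_mul, integral_indicator₀ hpos]

theorem exists_coe_eq_nsmul_coe_div (t : UnitAddCircle) {N : ℕ} (hN : N ≠ 0) :
    ∃ s : ℝ, |s| ≤ 1 / N ∧ t = N • (s : UnitAddCircle) := by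
  induction t using QuotientAddGroup.induction_on with
  | H y =>
    refine ⟨Int.fract y / N, ?_, ?_⟩
    · rw [abs_of_nonneg (by positivity)]
      gcongr
      exact (Int.fract_lt_one y).le
    · rw [← AddCircle.coe_nsmul, nsmul_eq_mul, mul_div_cancel₀ _ (by positivity)]
      exact (AddCircle.coe_fract y).symm

theorem measureReal_symmDiff_pos_preimage_add_le_translationEnergy {g : UnitAddCircle → ℝ}
    (hg : MemLp g 2) {ε : ℝ} (hε : 0 < ε) {N : ℕ} (hN : N ≠ 0) (t : UnitAddCircle) :
    volume.real ({x | 0 < g x} ∆ ((· + t) ⁻¹' {x | 0 < g x})) ≤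
      10 * (N * translationEnergy (fun x => (g x : ℂ)) N) / ε ^ 2 +
        2 * N * volume.real {x | |g x| ≤ ε} := by
  obtain ⟨s, hs, rfl⟩ := exists_coe_eq_nsmul_coe_div t hN
  have htrans : ∫ x, ‖g (x + s) - g x‖ ^ 2 ≤
      40 * translationEnergy (fun x => (g x : ℂ)) N := by
    simpa [← Complex.ofReal_sub] using integral_sq_norm_translate_sub_le hg.ofReal hs
  calc _ ≤ N * ((∫ x, ‖g (x + s) - g x‖ ^ 2) / (2 * ε) ^ 2 + 2 * volume.real {x | |g x| ≤ ε}) := by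
        refine (measureReal_symmDiff_preimage_add_nsmul_le _ _ _ _).trans ?_
        gcongr
        exact measureReal_symmDiff_pos_preimage_add_le hg hε s
    _ ≤ N * (40 * translationEnergy (fun x => (g x : ℂ)) N / (2 * ε) ^ 2 +
        2 * volume.real {x | |g x| ≤ ε}) := by gcongr
    _ = _ := by
        field_simp
        ring

theorem HalfEnergyLE.integral_sq_norm_le {f : UnitAddCircle → ℂ} {E : ℝ} (hf : MemLp f 2)
    (hE : HalfEnergyLE f E) (hmean : fourierCoeff f 0 = 0) : ∫ x, ‖f x‖ ^ 2 ≤ E := by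
  refine hasSum_le_of_sum_le (hasSum_sq_fourierCoeff_of_memLp hf) fun S =>
    le_trans (Finset.sum_le_sum fun k _ => ?_) (hE S)
  rcases eq_or_ne k 0 with rfl | hk
  · simp [hmean]
  · exact le_mul_of_one_le_left (by positivity) (by exact_mod_cast Int.one_le_abs hk)

theorem HalfEnergyLE.mul_one_sub_measureReal_le {g : UnitAddCircle → ℝ} {E : ℝ}
    (hg : MemLp g 2) (hE : HalfEnergyLE (fun x => (g x : ℂ)) E) (hmean : ∫ x, g x = 0)
    {J : ℕ} (hJ : J ≠ 0) {ε b : ℝ} (hε : 0 < ε) (hb : 0 < b) :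
    ε * (1 - volume.real {x | |g x| ≤ ε}) ≤ b * E + (60 * E / (J * ε ^ 2) +
      2 * 2 ^ J * volume.real {x | |g x| ≤ ε}) / b := by
  have := isProbabilityMeasure_volume_unitAddCircle
  obtain ⟨j, hj, hjE⟩ := hE.exists_two_pow_mul_translationEnergy_le hg.ofReal hJ
  have hη (t : UnitAddCircle) : volume.real ({x | 0 < g x} ∆ ((· + t) ⁻¹' {x | 0 < g x})) ≤
      60 * E / (J * ε ^ 2) + 2 * 2 ^ J * volume.real {x | |g x| ≤ ε} := by
    have h := measureReal_symmDiff_pos_preimage_add_le_translationEnergy hg hε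
      (N := 2 ^ j) (by positivity) t
    push_cast at h
    calc _ ≤ _ := h
      _ ≤ 10 * (6 * E / J) / ε ^ 2 + 2 * 2 ^ J * volume.real {x | |g x| ≤ ε} := by
          gcongr
          · exact hjE
          · norm_num
      _ = 60 * E / (J * ε ^ 2) + 2 * 2 ^ J * volume.real {x | |g x| ≤ ε} := by
          field_simp
          ring
  have hpos := setIntegral_le_of_measureReal_symmDiff_le hg hmean
    (nullMeasurableSet_lt aemeasurable_const hg.aestronglyMeasurable.aemeasurable) hb hη
  have hsq : ∫ x, ‖g x‖ ^ 2 ≤ E := by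
    simpa using hE.integral_sq_norm_le hg.ofReal (by simp [fourierCoeff_ofReal_zero, hmean])
  linarith [mul_one_sub_measureReal_abs_le_le (hg.integrable one_le_two) hmean hε.le,
    mul_le_mul_of_nonneg_left hsq hb.le]

theorem exists_forall_le_measureReal_abs_le {E ε : ℝ} (hE : 0 ≤ E) (hε : 0 < ε) :
    ∃ δ > 0, ∀ g : UnitAddCircle → ℝ, MemLp g 2 → HalfEnergyLE (fun x => (g x : ℂ)) E →
      ∫ x, g x = 0 → δ ≤ volume.real {x | |g x| ≤ ε} := by
  set b := ε / (4 * (E + 1)) with hb_def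
  have hb : 0 < b := by positivity
  obtain ⟨J, hJ⟩ := exists_nat_gt (240 * E / (ε ^ 3 * b))
  have hJ0 : (0 : ℝ) < J := lt_of_le_of_lt (by positivity) hJ
  refine ⟨ε / 2 / (ε + 2 * 2 ^ J / b), by positivity, fun g hg hgE hmean => ?_⟩
  have h := hgE.mul_one_sub_measureReal_le hg hmean (Nat.cast_pos.1 hJ0).ne' hε hb
  set z := volume.real {x | |g x| ≤ ε}
  have hbE : b * E ≤ ε / 4 := by
    rw [hb_def, div_mul_eq_mul_div, div_le_div_iff₀ (by positivity) (by norm_num)]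
    linarith
  have hJE : 60 * E / (J * ε ^ 2) / b ≤ ε / 4 := by
    rw [div_lt_iff₀ (by positivity)] at hJ
    rw [div_div, div_le_div_iff₀ (by positivity) (by norm_num)]
    linarith
  rw [div_le_iff₀ (by positivity), mul_add, mul_div_left_comm]
  rw [add_div, mul_div_assoc (2 * 2 ^ J)] at h
  linarith

end NearMean

section LargeDeviation

theorem HalfEnergyLE.sub_const {f : UnitAddCircle → ℂ} {E : ℝ} (hf : Integrable f)
    (hE : HalfEnergyLE f E) (a : ℂ) : HalfEnergyLE (fun x => f x - a) E := by
  have := isProbabilityMeasure_volume_unitAddCircle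
  refine fun S => le_trans (Finset.sum_le_sum fun k _ => ?_) (hE S)
  rcases eq_or_ne k 0 with rfl | hk
  · simp
  · have hconst : fourierCoeff (fun _ : UnitAddCircle => a) k = 0 := by
      simpa [hk] using fourierCoeff_sum_mul_fourier {0} (fun _ => a) k
    rw [fourierCoeff_sub hf (integrable_const a), hconst, sub_zero]

theorem exists_forall_measureReal_lt_abs_fejerAverage_sub_integral_le_one_sub {E ε : ℝ}
    (hE : 0 ≤ E) (hε : 0 < ε) :
    ∃ δ > 0, ∀ u : UnitAddCircle → ℝ, MemLp u 2 → HalfEnergyLE (fun x => (u x : ℂ)) E →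
      ∀ (ω : UnitAddCircle) (M : ℕ), M ≠ 0 →
        volume.real {x | ε < |fejerAverage u ω M x - ∫ y, u y|} ≤ 1 - δ := by
  have := isProbabilityMeasure_volume_unitAddCircle
  obtain ⟨δ, hδ, h⟩ := exists_forall_le_measureReal_abs_le hE hε
  refine ⟨δ, hδ, fun u hu huE ω M hM => ?_⟩
  have hint := hu.integrable one_le_two
  have hF := memLp_fejerAverage hu ω M
  have hg : MemLp (fun x => fejerAverage u ω M x - ∫ y, u y) 2 := hF.sub (memLp_const _)
  have henergy : HalfEnergyLE (fun x => ((fejerAverage u ω M x - ∫ y, u y : ℝ) : ℂ)) E := by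
    simpa using (halfEnergyLE_fejerAverage hint huE ω M).sub_const
      (hF.ofReal.integrable one_le_two) (∫ y, u y : ℝ)
  have hmean : ∫ x, (fejerAverage u ω M x - ∫ y, u y) = 0 := by
    have hzero := fourierCoeff_fejerAverage_zero hint ω hM
    rw [fourierCoeff_ofReal_zero, Complex.ofReal_inj] at hzero
    rw [integral_sub (hF.integrable one_le_two) (integrable_const _), hzero]
    simp
  have hcompl : {x | ε < |fejerAverage u ω M x - ∫ y, u y|} =
      {x | |fejerAverage u ω M x - ∫ y, u y| ≤ ε}ᶜ := by
    ext x
    simp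
  rw [hcompl, probReal_compl_eq_one_sub₀ (nullMeasurableSet_le
    hg.aestronglyMeasurable.aemeasurable.abs aemeasurable_const)]
  linarith [h _ hg henergy hmean]

theorem exists_forall_measureReal_lt_abs_fejerAverage_sub_integral_lt {A c : ℝ} (hA : 0 ≤ A)
    (hc : 0 < c) {E : ℝ} (hE : 0 ≤ E) :
    ∃ c' > 0, ∀ u : UnitAddCircle → ℝ, MemLp u 2 → HalfEnergyLE (fun x => (u x : ℂ)) E →
      ∀ (ω : UnitAddCircle) (M : ℕ), M ≠ 0 →
        (∀ k : ℤ, 0 < |k| → |k| ≤ (M : ℤ) → c * |(k : ℝ)| ^ (-A) < ‖k • ω‖) →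
        volume.real {x | (M : ℝ) ^ (-(1 / (4 * (1 + A)))) <
            |fejerAverage u ω M x - ∫ y, u y|} <
          Real.exp (-(c' * (M : ℝ) ^ (1 / (4 * (1 + A))))) := by
  have := isProbabilityMeasure_volume_unitAddCircle
  obtain ⟨M₀, hlarge⟩ :=
    exists_forall_ge_measureReal_lt_abs_fejerAverage_sub_integral_lt hA hc E
  set σ := 1 / (4 * (1 + A))
  have : 0 ≤ σ := by positivity
  have hM₀ : (0 : ℝ) < (M₀ + 1 : ℕ) := by positivity
  obtain ⟨δ, hδ, hsmall⟩ := exists_forall_measureReal_lt_abs_fejerAverage_sub_integral_le_one_sub hE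
    (Real.rpow_pos_of_pos hM₀ (-σ))
  refine ⟨min (1 / 2) (δ / (M₀ + 1 : ℕ) ^ σ), by positivity, fun u hu huE ω M hM hω => ?_⟩
  rcases le_total M₀ M with hMM | hMM
  · refine (hlarge u hu huE ω M hMM hω).trans_le (Real.exp_le_exp.2 (neg_le_neg ?_))
    gcongr
    exact min_le_left _ _
  · have hMσ : (M : ℝ) ^ σ ≤ (M₀ + 1 : ℕ) ^ σ := by
      gcongr
      omega
    have hthreshold : ((M₀ + 1 : ℕ) : ℝ) ^ (-σ) ≤ (M : ℝ) ^ (-σ) := by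
      rw [Real.rpow_neg hM₀.le, Real.rpow_neg M.cast_nonneg]
      gcongr
    calc _ ≤ volume.real {x | ((M₀ + 1 : ℕ) : ℝ) ^ (-σ) < |fejerAverage u ω M x - ∫ y, u y|} := by
          exact measureReal_mono fun x hx => hthreshold.trans_lt hx
      _ ≤ -δ + 1 := by linarith [hsmall u hu huE ω M hM]
      _ < Real.exp (-δ) := Real.add_one_lt_exp (by linarith)
      _ ≤ _ := by
          gcongr
          calc _ ≤ δ / (M₀ + 1 : ℕ) ^ σ * (M₀ + 1 : ℕ) ^ σ := by
                gcongr
                exact min_le_right _ _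
            _ = δ := div_mul_cancel₀ _ (by positivity)

end LargeDeviation

section BoundedMeasurable

/-- Bounded strongly measurable functions supported in `K`: the class of cut-off functions to which
the Fourier analysis of slices applies. -/
structure IsBoundedMeasurableOn {α E : Type*} [MeasurableSpace α] [NormedAddCommGroup E]
    (f : α → E) (K : Set α) : Prop where
  stronglyMeasurable : StronglyMeasurable f
  exists_norm_le : ∃ C, ∀ x, ‖f x‖ ≤ C
  eq_zero : ∀ x ∉ K, f x = 0

variable {α β E : Type*} [MeasurableSpace α] [MeasurableSpace β] [NormedAddCommGroup E]

theorem IsBoundedMeasurableOn.memLp {f : α → E} {K : Set α} (hf : IsBoundedMeasurableOn f K)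
    {μ : Measure α} (hK : μ K ≠ ⊤) (p : ENNReal) : MemLp f p μ := by
  obtain ⟨C, hC⟩ := hf.exists_norm_le
  refine (memLp_indicator_const p (measurableSet_toMeasurable μ K) C
    (.inr (by rwa [measure_toMeasurable]))).mono hf.stronglyMeasurable.aestronglyMeasurable
    (.of_forall fun x => ?_)
  by_cases hx : x ∈ K
  · rw [Set.indicator_of_mem (subset_toMeasurable μ K hx)]
    exact (hC x).trans (le_abs_self C)
  · rw [hf.eq_zero x hx, norm_zero]
    exact norm_nonneg _

theorem IsBoundedMeasurableOn.integrable {f : α → E} {K : Set α}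
    (hf : IsBoundedMeasurableOn f K) {μ : Measure α} (hK : μ K ≠ ⊤) : Integrable f μ :=
  memLp_one_iff_integrable.1 (hf.memLp hK 1)

theorem IsBoundedMeasurableOn.sq_norm {f : α → E} {K : Set α} (hf : IsBoundedMeasurableOn f K) :
    IsBoundedMeasurableOn (fun x => ‖f x‖ ^ 2) K := by
  obtain ⟨C, hC⟩ := hf.exists_norm_le
  refine ⟨hf.1.norm.pow 2, ⟨C ^ 2, fun x => ?_⟩, fun x hx => by simp [hf.3 x hx]⟩
  rw [norm_pow, norm_norm]
  gcongr
  exact hC x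

theorem IsBoundedMeasurableOn.mono {f : α → E} {K L : Set α} (hf : IsBoundedMeasurableOn f K)
    (h : K ⊆ L) : IsBoundedMeasurableOn f L :=
  ⟨hf.1, hf.2, fun x hx => hf.3 x fun hK => hx (h hK)⟩

theorem IsBoundedMeasurableOn.comp {f : α → E} {K : Set α} (hf : IsBoundedMeasurableOn f K)
    {g : β → α} (hg : Measurable g) : IsBoundedMeasurableOn (fun x => f (g x)) (g ⁻¹' K) :=
  ⟨hf.1.comp_measurable hg, hf.2.imp fun _ hC x => hC (g x), fun x hx => hf.3 (g x) hx⟩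

theorem IsBoundedMeasurableOn.sub {f g : α → E} {K : Set α} (hf : IsBoundedMeasurableOn f K)
    (hg : IsBoundedMeasurableOn g K) : IsBoundedMeasurableOn (fun x => f x - g x) K := by
  obtain ⟨C, hC⟩ := hf.exists_norm_le
  obtain ⟨D, hD⟩ := hg.exists_norm_le
  exact ⟨hf.1.sub hg.1, ⟨C + D, fun x => (norm_sub_le _ _).trans (add_le_add (hC x) (hD x))⟩,
    fun x hx => by rw [hf.3 x hx, hg.3 x hx, sub_zero]⟩

theorem IsBoundedMeasurableOn.mul {R : Type*} [NormedRing R] {f g : α → R} {K L : Set α}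
    (hf : IsBoundedMeasurableOn f K) (hg : IsBoundedMeasurableOn g L) :
    IsBoundedMeasurableOn (fun x => f x * g x) K := by
  obtain ⟨C, hC⟩ := hf.exists_norm_le
  obtain ⟨D, hD⟩ := hg.exists_norm_le
  exact ⟨hf.1.mul hg.1, ⟨C * D, fun x => (norm_mul_le _ _).trans
    (mul_le_mul (hC x) (hD x) (norm_nonneg _) ((norm_nonneg _).trans (hC x)))⟩,
    fun x hx => by rw [hf.3 x hx, zero_mul]⟩

end BoundedMeasurable

section RealLine

theorem measurable_fourier_coe (k : ℤ) :
    Measurable fun x : ℝ => (fourier k (x : UnitAddCircle) : ℂ) :=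
  ((fourier k).continuous.comp (AddCircle.continuous_mk' 1)).measurable

theorem isBoundedMeasurableOn_fourier (k : ℤ) :
    IsBoundedMeasurableOn (fun x : ℝ => (fourier k (x : UnitAddCircle) : ℂ)) Set.univ :=
  ⟨(measurable_fourier_coe k).stronglyMeasurable, ⟨1, fun _ => (norm_fourier_apply _ _).le⟩,
    fun _ hx => absurd (Set.mem_univ _) hx⟩

theorem IsBoundedMeasurableOn.fourier_mul {f : ℝ → ℂ} {K : Set ℝ}
    (hf : IsBoundedMeasurableOn f K) (k : ℤ) :
    IsBoundedMeasurableOn (fun x : ℝ => fourier k (x : UnitAddCircle) * f x) K := by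
  simpa only [mul_comm] using hf.mul (isBoundedMeasurableOn_fourier k)

theorem norm_integral_fourier_mul_le {f : ℝ → ℂ} {N C : ℝ} (hN : 0 ≤ N) (hC : ∀ x, ‖f x‖ ≤ C)
    (h0 : ∀ x ∉ Set.Ioc (-N) N, f x = 0) (k : ℤ) :
    ‖∫ x : ℝ, fourier k (x : UnitAddCircle) * f x‖ ≤ C * (2 * N) := by
  rw [← setIntegral_eq_integral_of_forall_compl_eq_zero (s := Set.Ioc (-N) N)
    fun x hx => by rw [h0 x hx, mul_zero]]
  refine (norm_setIntegral_le_of_norm_le_const (C := C) measure_Ioc_lt_top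
    fun x _ => ?_).trans_eq ?_
  · rw [norm_mul, norm_fourier_apply, one_mul]
    exact hC x
  · rw [Real.volume_real_Ioc_of_le (by linarith)]
    ring

theorem sum_sq_norm_integral_fourier_mul_le {f : ℝ → ℂ} {N : ℕ} (hN : 0 < N)
    (hf : IsBoundedMeasurableOn f (Set.Ioc (-N : ℝ) N)) (S : Finset ℤ) :
    ∑ k ∈ S, ‖∫ x : ℝ, fourier (-k) (x : UnitAddCircle) * f x‖ ^ 2 ≤
      2 * N * ∫ x, ‖f x‖ ^ 2 := by
  have hN' : (0 : ℝ) < N := by exact_mod_cast hN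
  have hN₀ : (N : ℂ) ≠ 0 := by exact_mod_cast hN.ne'
  have hlt : -(N : ℝ) < N := by linarith
  have hinterval {E : Type} [NormedAddCommGroup E] [NormedSpace ℝ E] {g : ℝ → E}
      (hg : ∀ x ∉ Set.Ioc (-N : ℝ) N, g x = 0) : ∫ x in (-N : ℝ)..N, g x = ∫ x, g x := by
    rw [intervalIntegral.integral_of_le hlt.le, setIntegral_eq_integral_of_forall_compl_eq_zero hg]
  have hcoeff (k : ℤ) : fourierCoeffOn hlt f (2 * N * k) =
      (1 / (2 * N) : ℝ) • ∫ x : ℝ, fourier (-k) (x : UnitAddCircle) * f x := by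
    rw [fourierCoeffOn_eq_integral, hinterval fun x hx => by rw [hf.eq_zero x hx, smul_zero]]
    congr 1
    · ring
    · refine integral_congr_ae (.of_forall fun x => ?_)
      simp only [fourier_coe_apply, smul_eq_mul]
      congr 2
      push_cast
      field_simp
      ring
  have hsum := sum_le_hasSum (S.image fun k : ℤ => 2 * N * k) (fun _ _ => by positivity)
    (hasSum_sq_fourierCoeffOn hlt ((hf.memLp measure_Ioc_lt_top.ne 2).restrict _))
  rw [Finset.sum_image fun a _ b _ h => by simpa [hN.ne'] using h, hinterval fun x hx => by
    rw [hf.eq_zero x hx, norm_zero, zero_pow two_ne_zero]] at hsum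
  simp only [hcoeff, norm_smul, mul_pow, ← Finset.mul_sum, smul_eq_mul, Real.norm_eq_abs,
    sq_abs] at hsum
  calc _ = (2 * N) ^ 2 * ((1 / (2 * N)) ^ 2 *
        ∑ k ∈ S, ‖∫ x : ℝ, fourier (-k) (x : UnitAddCircle) * f x‖ ^ 2) := by field_simp
    _ ≤ (2 * N) ^ 2 * (((N : ℝ) - -N)⁻¹ * ∫ x, ‖f x‖ ^ 2) := by gcongr
    _ = 2 * N * ∫ x, ‖f x‖ ^ 2 := by field_simp; ring

end RealLine

section PlaneCoefficients

/-- The square `(-N, N] × (-N, N]` in the complex plane. -/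
def square (N : ℝ) : Set ℂ := Set.Ioc (-N) N ×ℂ Set.Ioc (-N) N

/-- The Fourier coefficient at the integer frequency `k` of the restriction of `f` to the
horizontal line of height `y`. -/
noncomputable def sliceCoeff (f : ℂ → ℂ) (k : ℤ) (y : ℝ) : ℂ :=
  ∫ x : ℝ, fourier (-k) (x : UnitAddCircle) * f (x + y * Complex.I)

/-- The two-dimensional Fourier coefficient of `f` at the integer frequency `(k, l)`. -/
noncomputable def planeCoeff (f : ℂ → ℂ) (k l : ℤ) : ℂ :=
  ∫ y : ℝ, fourier (-l) (y : UnitAddCircle) * sliceCoeff f k y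

theorem mem_square {N : ℝ} {z : ℂ} :
    z ∈ square N ↔ z.re ∈ Set.Ioc (-N) N ∧ z.im ∈ Set.Ioc (-N) N :=
  Complex.mem_reProdIm

theorem square_mono {M N : ℝ} (h : M ≤ N) : square M ⊆ square N :=
  fun _ hz => ⟨Set.Ioc_subset_Ioc (neg_le_neg h) h hz.1,
    Set.Ioc_subset_Ioc (neg_le_neg h) h hz.2⟩

theorem volume_square_ne_top (N : ℝ) : volume (square N) ≠ ⊤ :=
  ((Metric.isBounded_Ioc _ _).reProdIm (Metric.isBounded_Ioc _ _)).measure_lt_top.ne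

theorem integrable_add_mul_I {g : ℂ → ℝ} (hg : Integrable g) :
    Integrable fun p : ℝ × ℝ => g (p.1 + p.2 * Complex.I) := by
  simp only [← Complex.mk_eq_add_mul_I]
  exact (Complex.volume_preserving_equiv_real_prod.symm.integrable_comp_emb
    Complex.measurableEquivRealProd.symm.measurableEmbedding).2 hg

theorem integral_complex_eq_integral_integral {g : ℂ → ℝ} (hg : Integrable g) :
    ∫ z, g z = ∫ y : ℝ, ∫ x : ℝ, g (x + y * Complex.I) := by
  rw [← Complex.volume_preserving_equiv_real_prod.symm.integral_comp', Measure.volume_eq_prod,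
    ← integral_prod_symm _ (integrable_add_mul_I hg)]
  simp only [← Complex.mk_eq_add_mul_I]
  rfl

variable {f : ℂ → ℂ} {N : ℝ}

theorem IsBoundedMeasurableOn.slice (hf : IsBoundedMeasurableOn f (square N)) (y : ℝ) :
    IsBoundedMeasurableOn (fun x : ℝ => f (x + y * Complex.I)) (Set.Ioc (-N) N) :=
  (hf.comp (by fun_prop)).mono fun x hx => by simpa using (mem_square.1 hx).1

theorem IsBoundedMeasurableOn.sliceCoeff (hN : 0 ≤ N) (hf : IsBoundedMeasurableOn f (square N))
    (k : ℤ) : IsBoundedMeasurableOn (sliceCoeff f k) (Set.Ioc (-N) N) := by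
  obtain ⟨C, hC⟩ := hf.exists_norm_le
  refine ⟨StronglyMeasurable.integral_prod_right
    (f := fun y x : ℝ => fourier (-k) (x : UnitAddCircle) * f (x + y * Complex.I))
    (((measurable_fourier_coe _).comp measurable_snd).stronglyMeasurable.mul
      (hf.1.comp_measurable (by fun_prop))), ⟨C * (2 * N), fun y =>
    norm_integral_fourier_mul_le hN (fun x => hC _) (hf.slice y).eq_zero _⟩, fun y hy => ?_⟩
  have h0 (x : ℝ) : f (x + y * Complex.I) = 0 :=
    hf.eq_zero _ fun h => hy (by simpa using (mem_square.1 h).2)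
  simp [_root_.sliceCoeff, h0]

theorem sliceCoeff_comp_add_right (f : ℂ → ℂ) (h : ℂ) (k : ℤ) (y : ℝ) :
    sliceCoeff (fun z => f (z + h)) k y =
      fourier k (h.re : UnitAddCircle) * sliceCoeff f k (y + h.im) := by
  have hinv : (fourier k (h.re : UnitAddCircle) : ℂ) * fourier (-k) (h.re : UnitAddCircle) = 1 := by
    rw [← fourier_add]; simp
  rw [sliceCoeff, sliceCoeff, ← integral_add_right_eq_self (fun x : ℝ =>
      fourier (-k) (x : UnitAddCircle) * f (x + (y + h.im : ℝ) * Complex.I)) h.re,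
    ← integral_const_mul]
  refine integral_congr_ae (.of_forall fun x => ?_)
  have hz : ((x + h.re : ℝ) : ℂ) + (y + h.im : ℝ) * Complex.I = x + y * Complex.I + h := by
    apply Complex.ext <;> simp
  simp only [hz, AddCircle.coe_add, fourier_add_apply]
  linear_combination (-(fourier (-k) (x : UnitAddCircle) * f (x + y * Complex.I + h))) * hinv

theorem planeCoeff_comp_add_right (f : ℂ → ℂ) (h : ℂ) (k l : ℤ) :
    planeCoeff (fun z => f (z + h)) k l =
      toCircle ((k * h.re + l * h.im : ℝ) : UnitAddCircle) * planeCoeff f k l := by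
  have hinv : (fourier l (h.im : UnitAddCircle) : ℂ) * fourier (-l) (h.im : UnitAddCircle) = 1 := by
    rw [← fourier_add]; simp
  have hphase : (toCircle ((k * h.re + l * h.im : ℝ) : UnitAddCircle) : ℂ) =
      fourier k (h.re : UnitAddCircle) * fourier l (h.im : UnitAddCircle) := by
    simp [fourier_apply, toCircle_add, ← zsmul_eq_mul]
  simp only [planeCoeff, sliceCoeff_comp_add_right]
  rw [hphase, ← integral_add_right_eq_self (fun y : ℝ => fourier (-l) (y : UnitAddCircle) *
      sliceCoeff f k y) h.im, ← integral_const_mul]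
  refine integral_congr_ae (.of_forall fun y => ?_)
  simp only [AddCircle.coe_add, fourier_add_apply]
  linear_combination (-(fourier (-l) (y : UnitAddCircle) * fourier k (h.re : UnitAddCircle) *
    sliceCoeff f k (y + h.im))) * hinv

theorem planeCoeff_sub {g : ℂ → ℂ} (hN : 0 ≤ N) (hf : IsBoundedMeasurableOn f (square N))
    (hg : IsBoundedMeasurableOn g (square N)) (k l : ℤ) :
    planeCoeff (fun z => f z - g z) k l = planeCoeff f k l - planeCoeff g k l := by
  have hslice (y : ℝ) :
      sliceCoeff (fun z => f z - g z) k y = sliceCoeff f k y - sliceCoeff g k y := by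
    simp only [sliceCoeff, mul_sub]
    exact integral_sub (((hf.slice y).fourier_mul _).integrable measure_Ioc_lt_top.ne)
      (((hg.slice y).fourier_mul _).integrable measure_Ioc_lt_top.ne)
  simp only [planeCoeff, hslice, mul_sub]
  exact integral_sub (((hf.sliceCoeff hN k).fourier_mul _).integrable measure_Ioc_lt_top.ne)
    (((hg.sliceCoeff hN k).fourier_mul _).integrable measure_Ioc_lt_top.ne)

theorem sum_sq_norm_planeCoeff_le {N : ℕ} (hN : 0 < N) (hf : IsBoundedMeasurableOn f (square N))
    (S T : Finset ℤ) :
    ∑ k ∈ S, ∑ l ∈ T, ‖planeCoeff f k l‖ ^ 2 ≤ (2 * N) ^ 2 * ∫ z, ‖f z‖ ^ 2 := by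
  have hslice (k : ℤ) : Integrable fun y => ‖sliceCoeff f k y‖ ^ 2 :=
    (hf.sliceCoeff N.cast_nonneg k).sq_norm.integrable measure_Ioc_lt_top.ne
  have hint : Integrable fun z => ‖f z‖ ^ 2 := hf.sq_norm.integrable (volume_square_ne_top N)
  calc ∑ k ∈ S, ∑ l ∈ T, ‖planeCoeff f k l‖ ^ 2
      ≤ ∑ k ∈ S, 2 * N * ∫ y, ‖sliceCoeff f k y‖ ^ 2 := Finset.sum_le_sum fun k _ =>
        sum_sq_norm_integral_fourier_mul_le hN (hf.sliceCoeff N.cast_nonneg k) T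
    _ = 2 * N * ∫ y, ∑ k ∈ S, ‖sliceCoeff f k y‖ ^ 2 := by
        rw [← Finset.mul_sum, integral_finsetSum S fun k _ => hslice k]
    _ ≤ 2 * N * ∫ y : ℝ, 2 * N * ∫ x : ℝ, ‖f (x + y * Complex.I)‖ ^ 2 := by
        gcongr
        · exact integrable_finsetSum S fun k _ => hslice k
        · exact (integrable_add_mul_I hint).integral_prod_right.const_mul _
        · exact fun y => sum_sq_norm_integral_fourier_mul_le hN (hf.slice y) S
    _ = (2 * N) ^ 2 * ∫ z, ‖f z‖ ^ 2 := by
        rw [integral_complex_eq_integral_integral hint, integral_const_mul]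
        ring

end PlaneCoefficients

section DifferenceEnergy

/-- The squared `L²` distance between `f` and its translate by `h`. -/
noncomputable def diffEnergy {E : Type*} [NormedAddCommGroup E] (f : ℂ → E) (h : ℂ) : ℝ :=
  ∫ z, ‖f (z + h) - f z‖ ^ 2

theorem circleIntegrable_of_norm_le {E : Type*} [NormedAddCommGroup E] {g : ℂ → E}
    {c : ℂ} {r C : ℝ} (hg : StronglyMeasurable g) (hC : ∀ z ∈ Metric.sphere c |r|, ‖g z‖ ≤ C) :
    CircleIntegrable g c r :=
  intervalIntegrable_const.mono_fun
    (hg.comp_measurable (continuous_circleMap c r).measurable).aestronglyMeasurable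
    (.of_forall fun θ => (hC _ (circleMap_mem_sphere' c r θ)).trans (Real.le_norm_self C))

section Fubini

variable {α E : Type*} [MeasurableSpace α] [NormedAddCommGroup E] {μ : Measure α} [SFinite μ]
  {F : ℂ → α → E} {K : Set α} {c : ℂ} {r : ℝ}

theorem integrable_circleMap_prod (hK : μ K ≠ ⊤)
    (hF : IsBoundedMeasurableOn (Function.uncurry fun θ => F (circleMap c r θ)) (Set.univ ×ˢ K)) :
    Integrable (Function.uncurry fun θ => F (circleMap c r θ))
      ((volume.restrict (Set.uIoc 0 (2 * Real.pi))).prod μ) := by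
  refine hF.integrable ?_
  rw [Measure.prod_prod, Measure.restrict_apply_univ]
  exact ENNReal.mul_ne_top measure_Ioc_lt_top.ne hK

variable [NormedSpace ℝ E]

theorem circleIntegrable_integral (hK : μ K ≠ ⊤)
    (hF : IsBoundedMeasurableOn (Function.uncurry fun θ => F (circleMap c r θ)) (Set.univ ×ˢ K)) :
    CircleIntegrable (fun h => ∫ x, F h x ∂μ) c r :=
  intervalIntegrable_iff.2 (integrable_circleMap_prod hK hF).integral_prod_left

theorem circleAverage_integral_comm (hK : μ K ≠ ⊤)
    (hF : IsBoundedMeasurableOn (Function.uncurry fun θ => F (circleMap c r θ)) (Set.univ ×ˢ K)) :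
    Real.circleAverage (fun h => ∫ x, F h x ∂μ) c r =
      ∫ x, Real.circleAverage (fun h => F h x) c r ∂μ := by
  simp only [Real.circleAverage_def]
  rw [integral_smul]
  congr 1
  exact intervalIntegral_integral_swap (integrable_circleMap_prod hK hF)

end Fubini

theorem circleAverage_sq_re_add_im (a b r : ℝ) :
    Real.circleAverage (fun h => (a * h.re + b * h.im) ^ 2) 0 r = r ^ 2 * (a ^ 2 + b ^ 2) / 2 := by
  have hexpand (θ : ℝ) : (a * (circleMap 0 r θ).re + b * (circleMap 0 r θ).im) ^ 2 =
      r ^ 2 * (a ^ 2 * Real.cos θ ^ 2 + 2 * a * b * (Real.sin θ * Real.cos θ) +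
        b ^ 2 * Real.sin θ ^ 2) := by
    simp only [circleMap_zero, Complex.re_ofReal_mul, Complex.im_ofReal_mul,
      Complex.exp_ofReal_mul_I_re, Complex.exp_ofReal_mul_I_im]
    ring
  have hint {F : ℝ → ℝ} (hF : Continuous F) : IntervalIntegrable F volume 0 (2 * Real.pi) :=
    hF.intervalIntegrable _ _
  simp only [Real.circleAverage_def, hexpand, intervalIntegral.integral_const_mul]
  rw [intervalIntegral.integral_add (hint (by fun_prop)) (hint (by fun_prop)),
    intervalIntegral.integral_add (hint (by fun_prop)) (hint (by fun_prop))]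
  simp only [intervalIntegral.integral_const_mul, integral_cos_sq, integral_sin_sq,
    integral_sin_mul_cos₁]
  simp
  field_simp

variable {f : ℂ → ℂ} {N : ℕ}

theorem IsBoundedMeasurableOn.comp_add_right {E : Type*} [NormedAddCommGroup E] {f : ℂ → E}
    {N : ℝ} (hf : IsBoundedMeasurableOn f (square N)) {h : ℂ} (hh : ‖h‖ ≤ 1) :
    IsBoundedMeasurableOn (fun z => f (z + h)) (square (N + 1)) := by
  refine (hf.comp (measurable_add_const h)).mono fun z hz => ?_
  obtain ⟨⟨h1, h2⟩, h3, h4⟩ := mem_square.1 (Set.mem_preimage.1 hz)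
  have hre := abs_le.1 ((Complex.abs_re_le_norm h).trans hh)
  have him := abs_le.1 ((Complex.abs_im_le_norm h).trans hh)
  rw [Complex.add_re] at h1 h2
  rw [Complex.add_im] at h3 h4
  exact mem_square.2 ⟨⟨by linarith, by linarith⟩, by linarith, by linarith⟩

theorem IsBoundedMeasurableOn.comp_add_circleMap {E : Type*} [NormedAddCommGroup E] {f : ℂ → E}
    {N r : ℝ} (hf : IsBoundedMeasurableOn f (square N)) (hr : |r| ≤ 1) :
    IsBoundedMeasurableOn (Function.uncurry fun θ z => f (z + circleMap 0 r θ))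
      (Set.univ ×ˢ square (N + 1)) := by
  obtain ⟨C, hC⟩ := hf.exists_norm_le
  exact ⟨hf.1.comp_measurable (by fun_prop), ⟨C, fun p => hC _⟩, fun p hp =>
    (hf.comp_add_right ((norm_circleMap_zero r p.1).trans_le hr)).eq_zero p.2
      fun h => hp ⟨Set.mem_univ _, h⟩⟩

theorem IsBoundedMeasurableOn.circleIntegrable_diffEnergy {E : Type*} [NormedAddCommGroup E]
    {f : ℂ → E} {N r : ℝ} (hf : IsBoundedMeasurableOn f (square N)) (hr : |r| ≤ 1) :
    CircleIntegrable (diffEnergy f) 0 r :=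
  circleIntegrable_integral (F := fun h z => ‖f (z + h) - f z‖ ^ 2) (volume_square_ne_top (N + 1))
    ((hf.comp_add_circleMap hr).sub ((hf.comp measurable_snd).mono fun _ hp =>
      ⟨Set.mem_univ _, square_mono (le_add_of_nonneg_right zero_le_one) hp⟩)).sq_norm

theorem sum_sq_phase_mul_sq_norm_planeCoeff_le_diffEnergy
    (hf : IsBoundedMeasurableOn f (square N)) {S T : Finset ℤ} {h : ℂ} (hh : ‖h‖ ≤ 1)
    (hphase : ∀ k ∈ S, ∀ l ∈ T, |k * h.re + l * h.im| ≤ 1 / 2) :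
    ∑ k ∈ S, ∑ l ∈ T, (k * h.re + l * h.im) ^ 2 * ‖planeCoeff f k l‖ ^ 2 ≤
      ((N + 1) / 2) ^ 2 * diffEnergy f h := by
  have hf' := hf.mono (square_mono (le_add_of_nonneg_right zero_le_one))
  have hshift := hf.comp_add_right hh
  have hcoeff (k l : ℤ) : planeCoeff (fun z => f (z + h) - f z) k l =
      (toCircle ((k * h.re + l * h.im : ℝ) : UnitAddCircle) - 1) * planeCoeff f k l := by
    rw [planeCoeff_sub (by positivity) hshift hf', planeCoeff_comp_add_right]
    ring
  have hphase_le {k l : ℤ} (hk : k ∈ S) (hl : l ∈ T) : 4 * |k * h.re + l * h.im| ≤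
      ‖(toCircle ((k * h.re + l * h.im : ℝ) : UnitAddCircle) : ℂ) - 1‖ := by
    rw [← (AddCircle.norm_coe_eq_abs_iff 1 one_ne_zero).2
      ((hphase k hk l hl).trans_eq (by norm_num))]
    exact four_mul_norm_le_norm_toCircle_sub_one _
  have hbessel := sum_sq_norm_planeCoeff_le (N := N + 1) N.succ_pos
    (by exact_mod_cast hshift.sub hf') S T
  calc _ ≤ ∑ k ∈ S, ∑ l ∈ T, ‖planeCoeff (fun z => f (z + h) - f z) k l‖ ^ 2 / 4 ^ 2 := by
        refine Finset.sum_le_sum fun k hk => Finset.sum_le_sum fun l hl => ?_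
        rw [hcoeff, norm_mul, le_div_iff₀' (by positivity), ← sq_abs (_ + _), ← mul_pow,
          ← mul_pow, ← mul_assoc]
        gcongr
        exact hphase_le hk hl
    _ ≤ (2 * (N + 1 : ℕ)) ^ 2 * diffEnergy f h / 4 ^ 2 := by
        simp only [← Finset.sum_div]
        gcongr
        exact hbessel
    _ = ((N + 1) / 2) ^ 2 * diffEnergy f h := by push_cast; ring

theorem eventually_forall_abs_phase_le (S T : Finset ℤ) :
    ∀ᶠ h : ℂ in 𝓝 0, ∀ k ∈ S, ∀ l ∈ T, |k * h.re + l * h.im| ≤ 1 / 2 := by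
  refine (Finset.eventually_all S).2 fun k _ => (Finset.eventually_all T).2 fun l _ => ?_
  have hcont : Continuous fun h : ℂ => |k * h.re + l * h.im| := by fun_prop
  exact (hcont.tendsto' 0 0 (by simp)).eventually_le_const (by norm_num)

theorem sum_mul_sq_norm_planeCoeff_le (hf : IsBoundedMeasurableOn f (square N)) {D : ℝ}
    (hD : ∀ᶠ r in 𝓝[>] 0, Real.circleAverage (diffEnergy f) 0 r ≤ D * r ^ 2) (S T : Finset ℤ) :
    ∑ k ∈ S, ∑ l ∈ T, ((k : ℝ) ^ 2 + (l : ℝ) ^ 2) * ‖planeCoeff f k l‖ ^ 2 ≤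
      (N + 1) ^ 2 / 2 * D := by
  obtain ⟨ε, hε, hphase⟩ := Metric.eventually_nhds_iff.1 (eventually_forall_abs_phase_le S T)
  have hsmall : ∀ᶠ r : ℝ in 𝓝[>] 0, 0 < r ∧ r < ε ∧ r ≤ 1 :=
    (eventually_mem_nhdsWithin).and
      (((eventually_lt_nhds hε).and (eventually_le_nhds one_pos)).filter_mono nhdsWithin_le_nhds)
  obtain ⟨r, hrD, hr, hrε, hr1⟩ := (hD.and hsmall).exists
  have hnorm {h : ℂ} (hh : h ∈ Metric.sphere 0 |r|) : ‖h‖ = r := by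
    rw [mem_sphere_zero_iff_norm.1 hh, abs_of_pos hr]
  have hci (k l : ℤ) : CircleIntegrable
      (fun h : ℂ => (k * h.re + l * h.im) ^ 2 * ‖planeCoeff f k l‖ ^ 2) 0 r :=
    ContinuousOn.circleIntegrable' (by fun_prop)
  have havg (k l : ℤ) : Real.circleAverage
      (fun h : ℂ => (k * h.re + l * h.im) ^ 2 * ‖planeCoeff f k l‖ ^ 2) 0 r =
        r ^ 2 / 2 * (((k : ℝ) ^ 2 + (l : ℝ) ^ 2) * ‖planeCoeff f k l‖ ^ 2) := by
    simp only [mul_comm _ (‖planeCoeff f k l‖ ^ 2), ← smul_eq_mul (‖planeCoeff f k l‖ ^ 2)]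
    rw [Real.circleAverage_fun_smul, circleAverage_sq_re_add_im]
    simp only [smul_eq_mul]
    ring
  have hle : Real.circleAverage (fun h => ∑ k ∈ S, ∑ l ∈ T,
      (k * h.re + l * h.im) ^ 2 * ‖planeCoeff f k l‖ ^ 2) 0 r ≤
        Real.circleAverage (fun h => ((N + 1) / 2 : ℝ) ^ 2 • diffEnergy f h) 0 r :=
    Real.circleAverage_mono (.fun_sum S fun k _ => .fun_sum T fun l _ => hci k l)
      (hf.circleIntegrable_diffEnergy (by rwa [abs_of_pos hr])).const_smul fun h hh =>
        sum_sq_phase_mul_sq_norm_planeCoeff_le_diffEnergy hf ((hnorm hh).trans_le hr1)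
          (hphase (by rwa [dist_zero_right, hnorm hh]))
  rw [Real.circleAverage_fun_smul, Real.circleAverage_fun_sum fun k _ => .fun_sum T fun l _ =>
    hci k l] at hle
  simp only [Real.circleAverage_fun_sum fun l _ => hci _ l, havg, ← Finset.mul_sum] at hle
  rw [smul_eq_mul] at hle
  have hbound : r ^ 2 / 2 * ∑ k ∈ S, ∑ l ∈ T, ((k : ℝ) ^ 2 + (l : ℝ) ^ 2) *
      ‖planeCoeff f k l‖ ^ 2 ≤ r ^ 2 / 2 * ((N + 1) ^ 2 / 2 * D) :=
    (hle.trans (mul_le_mul_of_nonneg_left hrD (by positivity))).trans_eq (by ring)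
  exact le_of_mul_le_mul_left hbound (by positivity)

end DifferenceEnergy

section AbsolutelySummable

theorem sum_range_div_sq_add_sq_le {k : ℕ} (hk : 0 < k) (n : ℕ) :
    ∑ l ∈ Finset.range (n + 1), (k : ℝ) / ((k : ℝ) ^ 2 + (l : ℝ) ^ 2) ≤
      1 / k + 2 - 2 * k / (k + n) := by
  have hk' : (0 : ℝ) < k := by exact_mod_cast hk
  induction n with
  | zero => simp [pow_two, hk'.ne']
  | succ n ih =>
    have hstep : (k : ℝ) / ((k : ℝ) ^ 2 + (n + 1 : ℕ) ^ 2) ≤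
        2 * k / (k + n) - 2 * k / (k + (n + 1 : ℕ)) := by
      push_cast
      rw [div_sub_div _ _ (by positivity) (by positivity),
        div_le_div_iff₀ (by positivity) (by positivity)]
      nlinarith [mul_nonneg hk'.le (sq_nonneg ((k : ℝ) - (n + 1))), mul_nonneg hk'.le n.cast_nonneg]
    rw [Finset.sum_range_succ]
    linarith

theorem sum_abs_div_sq_add_sq_le {k : ℤ} (hk : k ≠ 0) (T : Finset ℤ) :
    ∑ l ∈ T, |(k : ℝ)| / ((k : ℝ) ^ 2 + (l : ℝ) ^ 2) ≤ 5 := by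
  have hk' : 0 < k.natAbs := Int.natAbs_pos.2 hk
  have hk1 : (1 : ℝ) ≤ k.natAbs := by exact_mod_cast hk'
  set n := T.sup Int.natAbs
  have hT : T ⊆ Finset.Icc (-(n : ℤ)) n := fun l hl => by
    have : l.natAbs ≤ n := Finset.le_sup hl
    rw [Finset.mem_Icc]
    omega
  rw [← sq_abs (k : ℝ), ← Int.cast_abs, ← Nat.cast_natAbs]
  calc _ ≤ ∑ l ∈ Finset.Icc (-(n : ℤ)) n,
        (k.natAbs : ℝ) / ((k.natAbs : ℝ) ^ 2 + (l : ℝ) ^ 2) :=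
        Finset.sum_le_sum_of_subset_of_nonneg hT fun _ _ _ => by positivity
    _ ≤ 5 := by
        rw [Finset.sum_Icc_of_even_eq_range fun l => by simp]
        have hinv : 1 / (k.natAbs : ℝ) ≤ 1 := div_le_one_of_le₀ hk1 (by positivity)
        have hlast : 0 ≤ 2 * (k.natAbs : ℝ) / (k.natAbs + n) := by positivity
        have hzero : (k.natAbs : ℝ) / ((k.natAbs : ℝ) ^ 2 + ((0 : ℤ) : ℝ) ^ 2) = 1 / k.natAbs := by
          rw [Int.cast_zero, zero_pow two_ne_zero, add_zero, pow_two, div_mul_cancel_left₀,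
            one_div]
          positivity
        have hrange := sum_range_div_sq_add_sq_le hk' n
        rw [two_nsmul]
        simp only [Int.cast_natCast]
        linarith

theorem sum_abs_mul_sq_sum_le {a : ℤ → ℤ → ℝ} {D : ℝ}
    (hD : ∀ S T : Finset ℤ, ∑ k ∈ S, ∑ l ∈ T, ((k : ℝ) ^ 2 + (l : ℝ) ^ 2) * a k l ^ 2 ≤ D)
    (S T : Finset ℤ) : ∑ k ∈ S, |(k : ℝ)| * (∑ l ∈ T, a k l) ^ 2 ≤ 5 * D := by
  refine le_trans ?_ (mul_le_mul_of_nonneg_left (hD S T) (by norm_num))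
  rw [Finset.mul_sum]
  refine Finset.sum_le_sum fun k _ => ?_
  rcases eq_or_ne k 0 with rfl | hk
  · simp only [Int.cast_zero, abs_zero, zero_mul]
    positivity
  have hk2 (l : ℤ) : 0 < (k : ℝ) ^ 2 + (l : ℝ) ^ 2 := by positivity
  have hCS := Finset.sum_sq_le_sum_mul_sum_of_sq_le_mul T
    (f := fun l => |(k : ℝ)| / ((k : ℝ) ^ 2 + (l : ℝ) ^ 2))
    (g := fun l => ((k : ℝ) ^ 2 + (l : ℝ) ^ 2) * a k l ^ 2)
    (r := fun l => √|(k : ℝ)| * a k l) (fun _ _ => by positivity) (fun _ _ => by positivity)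
    fun l _ => by
      have := (hk2 l).ne'
      rw [mul_pow, Real.sq_sqrt (abs_nonneg _), ← mul_assoc, div_mul_cancel₀ _ this]
  rw [← Finset.mul_sum, mul_pow, Real.sq_sqrt (abs_nonneg _)] at hCS
  exact hCS.trans (mul_le_mul_of_nonneg_right (sum_abs_div_sq_add_sq_le hk T) (by positivity))

theorem summable_of_sum_mul_sq_le {a : ℤ → ℤ → ℝ} {D : ℝ} (ha : ∀ k l, 0 ≤ a k l)
    (hD : ∀ S T : Finset ℤ, ∑ k ∈ S, ∑ l ∈ T, ((k : ℝ) ^ 2 + (l : ℝ) ^ 2) * a k l ^ 2 ≤ D)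
    {k : ℤ} (hk : k ≠ 0) : Summable (a k) := by
  refine summable_of_sum_le (ha k) (c := √(5 * D)) fun T => Real.le_sqrt_of_sq_le ?_
  have h := sum_abs_mul_sq_sum_le hD {k} T
  rw [Finset.sum_singleton] at h
  refine (le_mul_of_one_le_left (sq_nonneg _) ?_).trans h
  exact_mod_cast Int.one_le_abs hk

theorem sum_abs_mul_sq_tsum_le {a : ℤ → ℤ → ℝ} {D : ℝ} (ha : ∀ k l, 0 ≤ a k l)
    (hD : ∀ S T : Finset ℤ, ∑ k ∈ S, ∑ l ∈ T, ((k : ℝ) ^ 2 + (l : ℝ) ^ 2) * a k l ^ 2 ≤ D)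
    (S : Finset ℤ) : ∑ k ∈ S, |(k : ℝ)| * (∑' l, a k l) ^ 2 ≤ 5 * D := by
  refine le_of_tendsto' (x := (atTop : Filter (Finset ℤ)))
    (tendsto_finsetSum S fun k _ => ?_) (sum_abs_mul_sq_sum_le hD S)
  rcases eq_or_ne k 0 with rfl | hk
  · simp
  · exact ((summable_of_sum_mul_sq_le ha hD hk).hasSum.pow 2).const_mul _

theorem ae_norm_le_tsum_norm_fourierCoeff {F : UnitAddCircle → ℂ} (hF : MemLp F 2)
    (hs : Summable fun l => ‖fourierCoeff F l‖) : ∀ᵐ y, ‖F y‖ ≤ ∑' l, ‖fourierCoeff F l‖ := by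
  rw [← haarAddCircle_eq_volume] at hF ⊢
  have hnorm (l : ℤ) : ‖fourierCoeff F l • (fourier l : C(UnitAddCircle, ℂ))‖ =
      ‖fourierCoeff F l‖ := by rw [norm_smul, fourier_norm, mul_one]
  have hs' : Summable fun l => ‖fourierCoeff F l • (fourier l : C(UnitAddCircle, ℂ))‖ := by
    simpa only [hnorm] using hs
  have hL2 := hasSum_fourier_series_L2 hF.toLp
  rw [fourierCoeff_congr_ae hF.coeFn_toLp] at hL2
  have heq := hL2.unique (by
    simpa using hs'.of_norm.hasSum.mapL (ContinuousMap.toLp 2 haarAddCircle ℂ))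
  filter_upwards [hF.coeFn_toLp, ContinuousMap.coeFn_toLp (𝕜 := ℂ) (p := 2) haarAddCircle
    (∑' l, fourierCoeff F l • (fourier l : C(UnitAddCircle, ℂ)))] with y hy hy'
  rw [← hy, heq, hy']
  refine (ContinuousMap.norm_coe_le_norm _ y).trans ((norm_tsum_le_tsum_norm hs').trans_eq ?_)
  simp only [hnorm]

theorem ae_norm_le_tsum_norm_integral_fourier_mul {F : ℝ → ℂ} {a : ℝ}
    (hF : IsBoundedMeasurableOn F (Set.Ioc a (a + 1)))
    (hs : Summable fun l : ℤ => ‖∫ y : ℝ, fourier (-l) (y : UnitAddCircle) * F y‖) :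
    ∀ᵐ y, ‖F y‖ ≤ ∑' l : ℤ, ‖∫ y : ℝ, fourier (-l) (y : UnitAddCircle) * F y‖ := by
  have hcoeff (l : ℤ) : fourierCoeff (liftIoc 1 a F) l =
      ∫ y : ℝ, fourier (-l) (y : UnitAddCircle) * F y := by
    rw [fourierCoeff_liftIoc_eq, fourierCoeffOn_eq_integral, add_sub_cancel_left, div_one, one_smul,
      intervalIntegral.integral_of_le (by linarith), setIntegral_eq_integral_of_forall_compl_eq_zero
        fun y hy => by rw [hF.eq_zero y hy, smul_zero]]
    rfl
  have hlift := ae_norm_le_tsum_norm_fourierCoeff (F := liftIoc 1 a F)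
    ((hF.memLp measure_Ioc_lt_top.ne 2).restrict _).memLp_liftIoc (by simpa only [hcoeff] using hs)
  simp only [hcoeff] at hlift
  have hIoc := (ae_restrict_iff' measurableSet_Ioc).1
    ((AddCircle.measurePreserving_mk 1 a).quasiMeasurePreserving.ae hlift)
  filter_upwards [hIoc] with y hy
  by_cases hmem : y ∈ Set.Ioc a (a + 1)
  · simpa only [liftIoc_coe_apply hmem] using hy hmem
  · rw [hF.eq_zero y hmem, norm_zero]
    exact tsum_nonneg fun l => norm_nonneg _

end AbsolutelySummable

section Caccioppoli

variable {φ w : ℂ → ℝ} {N : ℕ} {B r : ℝ}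

/-- The pairing of the localised function `φ ^ 2 * w` with the difference of `w` and its translate
by `h`: the weak form of the difference quotient that subharmonicity controls on average. -/
noncomputable def differencePairing (φ w : ℂ → ℝ) (h : ℂ) : ℝ :=
  ∫ z, φ z * φ z * w z * (w z - w (z + h))

theorem diffEnergy_mul_eq (hφ : IsBoundedMeasurableOn φ (square N))
    (hw : IsBoundedMeasurableOn w Set.univ) (h : ℂ) :
    diffEnergy (fun z => φ z * w z) h =
      differencePairing φ w h + differencePairing φ w (-h) +
        ∫ z, (φ (z + h) - φ z) ^ 2 * (w z * w (z + h)) := by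
  have hshift : Measurable fun z : ℂ => z + h := measurable_add_const h
  have hdiff : IsBoundedMeasurableOn (fun z => w z - w (z + h)) Set.univ := hw.sub (hw.comp hshift)
  have hpreim : volume ((fun z : ℂ => z + h) ⁻¹' square N) ≠ ⊤ := by
    rw [measure_preimage_add_right]
    exact volume_square_ne_top N
  have hint₁ := (((hφ.mul hφ).mul hw).mul hdiff).integrable (volume_square_ne_top N)
  have hint₂ := ((((hφ.mul hφ).mul hw).comp hshift).mul
    ((hw.comp hshift).sub hw)).integrable hpreim
  have hneg : differencePairing φ w (-h) =
      ∫ z, φ (z + h) * φ (z + h) * w (z + h) * (w (z + h) - w z) := by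
    rw [differencePairing, ← integral_add_right_eq_self _ h]
    simp only [add_neg_cancel_right]
  have hint₃ : Integrable fun z => (φ (z + h) - φ z) ^ 2 * (w z * w (z + h)) := by
    have hφd := ((hφ.comp hshift).mono Set.subset_union_left).sub
      (hφ.mono (Set.subset_union_right (s := (fun z : ℂ => z + h) ⁻¹' square N)))
    simpa only [pow_two] using ((hφd.mul hφd).mul (hw.mul (hw.comp hshift))).integrable
      (measure_union_ne_top hpreim (volume_square_ne_top N))
  rw [hneg, differencePairing, ← integral_add hint₁ hint₂,
    ← integral_add (hint₁.fun_add hint₂) hint₃]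
  refine integral_congr_ae (.of_forall fun z => ?_)
  simp only [Real.norm_eq_abs, sq_abs]
  ring

theorem isBoundedMeasurableOn_differencePairing (hφ : IsBoundedMeasurableOn φ (square N))
    (hw : IsBoundedMeasurableOn w Set.univ) (r : ℝ) :
    IsBoundedMeasurableOn (Function.uncurry fun θ z =>
      φ z * φ z * w z * (w z - w (z + circleMap 0 r θ))) (Set.univ ×ˢ square N) :=
  ((((hφ.mul hφ).mul hw).comp measurable_snd).mul ((hw.comp measurable_snd).sub
    (hw.comp (g := fun p : ℝ × ℂ => p.2 + circleMap 0 r p.1) (by fun_prop)))).mono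
      fun _ hp => ⟨Set.mem_univ _, hp⟩

theorem circleIntegrable_differencePairing (hφ : IsBoundedMeasurableOn φ (square N))
    (hw : IsBoundedMeasurableOn w Set.univ) (r : ℝ) :
    CircleIntegrable (differencePairing φ w) 0 r :=
  circleIntegrable_integral (F := fun h z => φ z * φ z * w z * (w z - w (z + h)))
    (volume_square_ne_top N) (isBoundedMeasurableOn_differencePairing hφ hw r)

theorem circleAverage_differencePairing_nonpos (hφ : IsBoundedMeasurableOn φ (square N))
    (hw : IsBoundedMeasurableOn w Set.univ) (hw0 : ∀ z, 0 ≤ w z)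
    (hsub : ∀ z, φ z ≠ 0 → w z ≤ Real.circleAverage w z r) :
    Real.circleAverage (differencePairing φ w) 0 r ≤ 0 := by
  obtain ⟨C, hC⟩ := hw.exists_norm_le
  have hci (z : ℂ) : CircleIntegrable (fun h => w (z + h)) 0 r :=
    circleIntegrable_of_norm_le (hw.1.comp_measurable (measurable_const_add z)) fun h _ => hC _
  have havg (z : ℂ) : Real.circleAverage (fun h => φ z * φ z * w z * (w z - w (z + h))) 0 r =
      φ z * φ z * w z * (w z - Real.circleAverage w z r) := by
    simp only [← smul_eq_mul (φ z * φ z * w z)]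
    rw [Real.circleAverage_fun_smul, Real.circleAverage_fun_sub (circleIntegrable_const _ _ _)
      (hci z), Real.circleAverage_const]
    simp only [add_comm z, Real.circleAverage_map_add_const]
  refine (circleAverage_integral_comm (F := fun h z => φ z * φ z * w z * (w z - w (z + h)))
    (volume_square_ne_top N) (isBoundedMeasurableOn_differencePairing hφ hw r)).trans_le
      (integral_nonpos fun z => ?_)
  simp only [havg, Pi.zero_apply]
  rcases eq_or_ne (φ z) 0 with hz | hz
  · simp [hz]
  · exact mul_nonpos_of_nonneg_of_nonpos (mul_nonneg (mul_self_nonneg _) (hw0 z))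
      (sub_nonpos.2 (hsub z hz))

theorem integral_sq_sub_mul_le {L : NNReal} (hφ : IsBoundedMeasurableOn φ (square N))
    (hL : LipschitzWith L φ) (hwB : ∀ z, w z ∈ Set.Icc 0 B) {h : ℂ} (hh : ‖h‖ ≤ 1) :
    ∫ z, (φ (z + h) - φ z) ^ 2 * (w z * w (z + h)) ≤
      volume.real (square (N + 1)) * (L * B) ^ 2 * ‖h‖ ^ 2 := by
  have hdiff := (hφ.comp_add_right hh).sub (hφ.mono (square_mono
    (le_add_of_nonneg_right zero_le_one)))
  have hB : 0 ≤ B := (hwB 0).1.trans (hwB 0).2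
  rw [← setIntegral_eq_integral_of_forall_compl_eq_zero (s := square (N + 1))
    fun z hz => by rw [hdiff.eq_zero z hz]; ring]
  refine (Real.le_norm_self _).trans ((norm_setIntegral_le_of_norm_le_const
    (C := (L * ‖h‖) ^ 2 * (B * B)) (volume_square_ne_top _).lt_top fun z _ => ?_).trans_eq
      (by ring))
  have hLip : |φ (z + h) - φ z| ≤ L * ‖h‖ := by simpa [dist_eq_norm] using hL.dist_le_mul (z + h) z
  rw [Real.norm_of_nonneg (mul_nonneg (sq_nonneg _) (mul_nonneg (hwB _).1 (hwB _).1)), ← sq_abs]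
  gcongr
  · exact mul_nonneg (hwB _).1 (hwB _).1
  · exact (hwB _).1
  · exact (hwB _).2
  · exact (hwB _).2

theorem circleAverage_diffEnergy_mul_le {L : NNReal} (hφ : IsBoundedMeasurableOn φ (square N))
    (hL : LipschitzWith L φ) (hw : IsBoundedMeasurableOn w Set.univ)
    (hwB : ∀ z, w z ∈ Set.Icc 0 B) (hr : |r| ≤ 1)
    (hsub : ∀ z, φ z ≠ 0 → w z ≤ Real.circleAverage w z r) :
    Real.circleAverage (diffEnergy fun z => φ z * w z) 0 r ≤
      volume.real (square (N + 1)) * (L * B) ^ 2 * r ^ 2 := by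
  have hneg (ρ : ℝ) : (fun θ => differencePairing φ w (-circleMap 0 ρ θ)) =
      fun θ => differencePairing φ w (circleMap 0 (-ρ) θ) := by
    simp [circleMap_zero]
  have hci := circleIntegrable_differencePairing hφ hw
  have hci' : CircleIntegrable (fun h => differencePairing φ w (-h)) 0 r := by
    rw [CircleIntegrable, hneg]
    exact hci (-r)
  have havg' : Real.circleAverage (fun h => differencePairing φ w (-h)) 0 r =
      Real.circleAverage (differencePairing φ w) 0 r := by
    rw [← Real.circleAverage_neg_radius, Real.circleAverage_def, hneg, neg_neg,
      Real.circleAverage_def]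
  have hnonpos := circleAverage_differencePairing_nonpos hφ hw (fun z => (hwB z).1) hsub
  set R := volume.real (square (N + 1)) * (L * B) ^ 2 * r ^ 2
  calc _ ≤ Real.circleAverage (fun h => differencePairing φ w h + differencePairing φ w (-h) + R)
        0 r := by
        refine Real.circleAverage_mono ((hφ.mul hw).circleIntegrable_diffEnergy hr)
          (((hci r).fun_add hci').fun_add (circleIntegrable_const _ _ _)) fun h hh => ?_
        have hh' : ‖h‖ = |r| := mem_sphere_zero_iff_norm.1 hh
        have hR := integral_sq_sub_mul_le hφ hL hwB (hh'.trans_le hr)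
        rw [hh', sq_abs] at hR
        rw [diffEnergy_mul_eq hφ hw]
        gcongr
    _ ≤ R := by
        rw [Real.circleAverage_fun_add ((hci r).fun_add hci') (circleIntegrable_const _ _ _),
          Real.circleAverage_fun_add (hci r) hci', havg', Real.circleAverage_const]
        linarith

end Caccioppoli

section Trace

variable {f : ℂ → ℂ} {N : ℝ}

theorem integral_fourier_mul_circleAverage (hf : IsBoundedMeasurableOn f (square N)) {r : ℝ}
    (hr : |r| ≤ 1) (k : ℤ) :
    ∫ x : ℝ, fourier (-k) (x : UnitAddCircle) * Real.circleAverage f x r =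
      Real.circleAverage (fun h => fourier k (h.re : UnitAddCircle) * sliceCoeff f k h.im) 0 r := by
  have hsupp : IsBoundedMeasurableOn (Function.uncurry fun θ (x : ℝ) =>
      f (x + circleMap 0 r θ) * fourier (-k) (x : UnitAddCircle))
      (Set.univ ×ˢ Set.Ioc (-(N + 1)) (N + 1)) :=
    (((hf.comp_add_circleMap hr).comp (g := fun p : ℝ × ℝ => (p.1, (p.2 : ℂ)))
      (by fun_prop)).mono (L := Set.univ ×ˢ Set.Ioc (-(N + 1)) (N + 1))
        fun _ hp => ⟨hp.1, (mem_square.1 hp.2).1⟩).mul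
          ((isBoundedMeasurableOn_fourier (-k)).comp measurable_snd)
  have hslice (h : ℂ) : fourier k (h.re : UnitAddCircle) * sliceCoeff f k h.im =
      ∫ x : ℝ, f (x + h) * fourier (-k) (x : UnitAddCircle) := by
    rw [← zero_add h.im, ← sliceCoeff_comp_add_right, sliceCoeff]
    simp [mul_comm]
  have havg (x : ℝ) : Real.circleAverage (fun h => f (x + h) * fourier (-k) (x : UnitAddCircle)) 0 r
      = fourier (-k) (x : UnitAddCircle) * Real.circleAverage f x r := by
    simp only [mul_comm (f _), ← smul_eq_mul (fourier (-k) (x : UnitAddCircle))]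
    rw [Real.circleAverage_fun_smul]
    simp only [add_comm (x : ℂ), Real.circleAverage_map_add_const]
  simp only [hslice]
  rw [circleAverage_integral_comm (F := fun h (x : ℝ) => f (x + h) * fourier (-k) (x :
    UnitAddCircle)) measure_Ioc_lt_top.ne hsupp]
  simp only [havg]

theorem ae_ae_circleMap_im {p : ℝ → Prop} (hmeas : MeasurableSet {y | p y}) (hp : ∀ᵐ y, p y) :
    ∀ᵐ r : ℝ, ∀ᵐ θ : ℝ, p (circleMap 0 r θ).im := by
  have hset : MeasurableSet {q : ℝ × ℝ | p (circleMap 0 q.1 q.2).im} :=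
    (show Measurable fun q : ℝ × ℝ => (circleMap 0 q.1 q.2).im by fun_prop) hmeas
  have hsin : ∀ᵐ θ : ℝ, θ ∉ Set.range fun n : ℤ => n * Real.pi :=
    (Set.countable_range _).ae_notMem volume
  rw [Measure.ae_ae_comm hset]
  filter_upwards [hsin] with θ hθ
  have hne : Real.sin θ ≠ 0 := fun h => hθ (Real.sin_eq_zero_iff.1 h)
  simpa [circleMap_zero, Complex.exp_ofReal_mul_I_im, mul_comm (Real.sin θ)] using
    (Measure.quasiMeasurePreserving_smul volume hne).ae hp

theorem norm_circleAverage_le {E : Type*} [NormedAddCommGroup E] [NormedSpace ℝ E] {g : ℂ → E}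
    {c : ℂ} {r C : ℝ} (hC : ∀ᵐ θ, ‖g (circleMap c r θ)‖ ≤ C) : ‖Real.circleAverage g c r‖ ≤ C := by
  have hint := intervalIntegral.norm_integral_le_of_norm_le_const_ae (a := 0) (b := 2 * Real.pi)
    (hC.mono fun _ h _ => h)
  rw [sub_zero, abs_of_pos Real.two_pi_pos] at hint
  rwa [Real.circleAverage_def, norm_smul, norm_inv, Real.norm_of_nonneg Real.two_pi_pos.le,
    inv_mul_le_iff₀ Real.two_pi_pos, mul_comm _ C]

theorem frequently_nhdsGT_of_ae {p : ℝ → Prop} (hp : ∀ᵐ r, p r) (a : ℝ) :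
    ∃ᶠ r in 𝓝[>] a, p r := by
  intro h
  obtain ⟨b, hb, hsub⟩ := mem_nhdsGT_iff_exists_Ioo_subset.1 h
  obtain ⟨r, hr, hpr⟩ := (Measure.dense_of_ae hp).exists_mem_open isOpen_Ioo (Set.nonempty_Ioo.2 hb)
  exact hsub hpr hr

theorem eventually_abs_le_one_nhdsGT : ∀ᶠ r : ℝ in 𝓝[>] 0, |r| ≤ 1 :=
  ((continuous_abs.tendsto' 0 0 abs_zero).eventually_le_const one_pos).filter_mono
    nhdsWithin_le_nhds

theorem tendsto_integral_fourier_mul_circleAverage (hf : IsBoundedMeasurableOn f (square N))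
    (hlim : ∀ x : ℝ, Tendsto (Real.circleAverage f x) (𝓝[>] 0) (𝓝 (f x))) (k : ℤ) :
    Tendsto (fun r => ∫ x : ℝ, fourier (-k) (x : UnitAddCircle) * Real.circleAverage f x r)
      (𝓝[>] 0) (𝓝 (sliceCoeff f k 0)) := by
  obtain ⟨C, hC⟩ := hf.exists_norm_le
  have hmeas (r : ℝ) : StronglyMeasurable fun x : ℝ => Real.circleAverage f x r := by
    simp only [Real.circleAverage_def, intervalIntegral.integral_of_le Real.two_pi_pos.le]
    exact (StronglyMeasurable.integral_prod_right (f := fun (x : ℝ) θ => f (circleMap x r θ))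
      (hf.1.comp_measurable (by unfold circleMap; fun_prop))).const_smul _
  have hzero {r x : ℝ} (hr : |r| ≤ 1) (hx : x ∉ Set.Ioc (-(N + 1)) (N + 1)) :
      Real.circleAverage f x r = 0 := by
    rw [← Real.circleAverage_map_add_const]
    refine Real.circleAverage_const_on_circle fun h hh => ?_
    rw [add_comm]
    exact (hf.comp_add_right ((mem_sphere_zero_iff_norm.1 hh).trans_le hr)).eq_zero _
      fun h => hx (mem_square.1 h).1
  have hbound : Integrable ((Set.Ioc (-(N + 1)) (N + 1)).indicator fun _ => C) :=
    (integrable_indicator_iff measurableSet_Ioc).2 (integrableOn_const measure_Ioc_lt_top.ne)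
  have hpointwise (x : ℝ) := (hlim x).const_mul (fourier (-k) (x : UnitAddCircle) : ℂ)
  convert tendsto_integral_filter_of_dominated_convergence
    ((Set.Ioc (-(N + 1)) (N + 1)).indicator fun _ => C) ?_ ?_ hbound (.of_forall hpointwise) using 2
  · simp [sliceCoeff]
  · exact .of_forall fun r =>
      ((measurable_fourier_coe _).stronglyMeasurable.mul (hmeas r)).aestronglyMeasurable
  · filter_upwards [eventually_abs_le_one_nhdsGT] with r hr
    refine .of_forall fun x => ?_
    rw [norm_mul, norm_fourier_apply, one_mul]
    by_cases hx : x ∈ Set.Ioc (-(N + 1)) (N + 1)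
    · rw [Set.indicator_of_mem hx]
      exact norm_circleAverage_le (.of_forall fun θ => hC _)
    · rw [Set.indicator_of_notMem hx, hzero hr hx, norm_zero]

theorem norm_sliceCoeff_zero_le (hf : IsBoundedMeasurableOn f (square N)) (hN : 0 ≤ N)
    (hlim : ∀ x : ℝ, Tendsto (Real.circleAverage f x) (𝓝[>] 0) (𝓝 (f x))) {k : ℤ} {A : ℝ}
    (hA : ∀ᵐ y, ‖sliceCoeff f k y‖ ≤ A) : ‖sliceCoeff f k 0‖ ≤ A := by
  have hcircle := ae_ae_circleMap_im (p := fun y => ‖sliceCoeff f k y‖ ≤ A)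
    (measurableSet_le (hf.sliceCoeff hN k).1.norm.measurable measurable_const) hA
  refine le_of_tendsto_of_frequently (tendsto_integral_fourier_mul_circleAverage hf hlim k).norm
    (((frequently_nhdsGT_of_ae hcircle 0).and_eventually eventually_abs_le_one_nhdsGT).mono
      fun r ⟨hr, hr1⟩ => ?_)
  rw [integral_fourier_mul_circleAverage hf hr1]
  refine norm_circleAverage_le (hr.mono fun θ hθ => ?_)
  rwa [norm_mul, norm_fourier_apply, one_mul]

theorem sum_abs_mul_sq_norm_sliceCoeff_zero_le {N : ℕ} (hf : IsBoundedMeasurableOn f (square N))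
    {a : ℝ} (hstrip : ∀ z : ℂ, z.im ∉ Set.Ioc a (a + 1) → f z = 0)
    (hlim : ∀ x : ℝ, Tendsto (Real.circleAverage f x) (𝓝[>] 0) (𝓝 (f x))) {D : ℝ}
    (hD : ∀ᶠ r in 𝓝[>] 0, Real.circleAverage (diffEnergy f) 0 r ≤ D * r ^ 2) (S : Finset ℤ) :
    ∑ k ∈ S, |(k : ℝ)| * ‖sliceCoeff f k 0‖ ^ 2 ≤ 5 * ((N + 1) ^ 2 / 2 * D) := by
  have hsum := sum_mul_sq_norm_planeCoeff_le hf hD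
  refine (Finset.sum_le_sum fun k _ => ?_).trans
    (sum_abs_mul_sq_tsum_le (fun k l => norm_nonneg (planeCoeff f k l)) hsum S)
  rcases eq_or_ne k 0 with rfl | hk
  · simp
  have hslice : IsBoundedMeasurableOn (sliceCoeff f k) (Set.Ioc a (a + 1)) :=
    ⟨(hf.sliceCoeff N.cast_nonneg k).1, (hf.sliceCoeff N.cast_nonneg k).2, fun y hy => by
      have h0 (x : ℝ) := hstrip (x + y * Complex.I) (by simpa using hy)
      simp [sliceCoeff, h0]⟩
  gcongr
  exact norm_sliceCoeff_zero_le hf N.cast_nonneg hlim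
    (ae_norm_le_tsum_norm_integral_fourier_mul hslice
      (summable_of_sum_mul_sq_le (fun k l => norm_nonneg (planeCoeff f k l)) hsum hk))

end Trace

section Cutoff

/-- The pyramid of height one over the rectangle `(0, 2) × (-1/2, 1/2)`: a Lipschitz cutoff whose
translates by integers sum to one along the real line. -/
noncomputable def cutoff (z : ℂ) : ℝ := max 0 (1 - max |z.re - 1| (2 * |z.im|))

theorem cutoff_mem_Icc (z : ℂ) : cutoff z ∈ Set.Icc 0 1 :=
  ⟨le_max_left _ _, max_le zero_le_one (sub_le_self _ ((abs_nonneg _).trans (le_max_left _ _)))⟩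

theorem cutoff_ne_zero_iff {z : ℂ} : cutoff z ≠ 0 ↔ |z.re - 1| < 1 ∧ 2 * |z.im| < 1 := by
  rw [cutoff, Ne, max_eq_left_iff, not_le, sub_pos, max_lt_iff]

theorem lipschitzWith_cutoff : LipschitzWith 2 cutoff := by
  refine .of_dist_le_mul fun z w => ?_
  have hre : |(|z.re - 1| - |w.re - 1|)| ≤ 2 * ‖z - w‖ := by
    have h := (abs_abs_sub_abs_le (z.re - 1) (w.re - 1)).trans_eq
      (congrArg abs (sub_sub_sub_cancel_right _ _ _))
    linarith [Complex.sub_re z w ▸ Complex.abs_re_le_norm (z - w), norm_nonneg (z - w)]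
  have him : |(2 * |z.im| - 2 * |w.im|)| ≤ 2 * ‖z - w‖ := by
    rw [← mul_sub, abs_mul, abs_two]
    gcongr
    exact (abs_abs_sub_abs_le _ _).trans (Complex.sub_im z w ▸ Complex.abs_im_le_norm (z - w))
  rw [Real.dist_eq, dist_eq_norm, NNReal.coe_ofNat]
  calc |cutoff z - cutoff w|
      ≤ |max |z.re - 1| (2 * |z.im|) - max |w.re - 1| (2 * |w.im|)| := by
        refine (abs_max_sub_max_le_max _ _ _ _).trans ?_
        rw [sub_self, abs_zero, max_eq_right (abs_nonneg _), sub_sub_sub_cancel_left, abs_sub_comm]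
    _ ≤ 2 * ‖z - w‖ := (abs_max_sub_max_le_max _ _ _ _).trans (max_le hre him)

theorem isBoundedMeasurableOn_cutoff : IsBoundedMeasurableOn cutoff (square 2) := by
  refine ⟨lipschitzWith_cutoff.continuous.stronglyMeasurable, ⟨1, fun z => ?_⟩, fun z hz => ?_⟩
  · rw [Real.norm_of_nonneg (cutoff_mem_Icc z).1]
    exact (cutoff_mem_Icc z).2
  · by_contra h
    obtain ⟨hre, him⟩ := cutoff_ne_zero_iff.1 h
    rw [abs_lt] at hre
    have := abs_lt.1 (show |z.im| < 2 by linarith)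
    exact hz (mem_square.2 ⟨⟨by linarith, by linarith⟩, by linarith, by linarith⟩)

theorem cutoff_ofReal_eq_zero {x : ℝ} (hx : x ∉ Set.Ioc 0 2) : cutoff x = 0 := by
  by_contra h
  have hre := abs_lt.1 (cutoff_ne_zero_iff.1 h).1
  rw [Complex.ofReal_re] at hre
  exact hx ⟨by linarith, by linarith⟩

theorem cutoff_ofReal_add_cutoff_ofReal_add_one {x : ℝ} (hx : x ∈ Set.Icc 0 1) :
    cutoff x + cutoff (x + 1 : ℝ) = 1 := by
  have h1 : |x - 1| = 1 - x := by rw [abs_sub_comm, abs_of_nonneg (sub_nonneg.2 hx.2)]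
  simp [cutoff, h1, abs_of_nonneg hx.1, hx.1, hx.2]

theorem integral_cutoff_mul {g : UnitAddCircle → ℂ} (hg : Integrable g) :
    ∫ x : ℝ, cutoff x * g (x : UnitAddCircle) = ∫ x, g x := by
  have hcut : Continuous fun x : ℝ => (cutoff x : ℂ) := Complex.continuous_ofReal.comp
    (lipschitzWith_cutoff.continuous.comp Complex.continuous_ofReal)
  have hper : Function.Periodic (fun x : ℝ => g (x : UnitAddCircle)) 1 := fun x => by
    simp
  have hint (a b : ℝ) :
      IntervalIntegrable (fun x : ℝ => cutoff x * g (x : UnitAddCircle)) volume a b := by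
    refine (hper.intervalIntegrable₀ one_ne_zero ?_ a b).continuousOn_mul hcut.continuousOn
    rw [intervalIntegrable_iff_integrableOn_Ioc_of_le zero_le_one]
    have := (AddCircle.measurePreserving_mk 1 0).integrable_comp_of_integrable hg
    rwa [zero_add] at this
  have hshift : ∫ x in (1 : ℝ)..2, cutoff x * g (x : UnitAddCircle) =
      ∫ x in (0 : ℝ)..1, cutoff (x + 1 : ℝ) * g (x : UnitAddCircle) := by
    have h := intervalIntegral.integral_comp_add_right (a := 0) (b := 1)
      (fun x : ℝ => cutoff x * g (x : UnitAddCircle)) 1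
    simpa [one_add_one_eq_two] using h.symm
  have hint' : IntervalIntegrable (fun x : ℝ => cutoff (x + 1 : ℝ) * g (x : UnitAddCircle))
      volume 0 1 := by
    simpa using (hint (0 + 1) (1 + 1)).comp_add_right 1
  calc ∫ x : ℝ, cutoff x * g (x : UnitAddCircle)
      = ∫ x in (0 : ℝ)..2, cutoff x * g (x : UnitAddCircle) := by
        rw [intervalIntegral.integral_of_le zero_le_two,
          setIntegral_eq_integral_of_forall_compl_eq_zero fun x hx => by
            rw [cutoff_ofReal_eq_zero hx, Complex.ofReal_zero, zero_mul]]
    _ = ∫ x in (0 : ℝ)..1, g (x : UnitAddCircle) := by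
        rw [← intervalIntegral.integral_add_adjacent_intervals (hint 0 1) (hint 1 2), hshift,
          ← intervalIntegral.integral_add (hint 0 1) hint']
        refine intervalIntegral.integral_congr fun x hx => ?_
        rw [Set.uIcc_of_le zero_le_one] at hx
        simp only [← add_mul, ← Complex.ofReal_add, cutoff_ofReal_add_cutoff_ofReal_add_one hx,
          Complex.ofReal_one, one_mul]
    _ = ∫ x, g x := by simpa using UnitAddCircle.intervalIntegral_preimage 0 g

end Cutoff

section Subharmonic

namespace SubharmonicOn

variable {f g : ℂ → ℝ} {U : Set ℂ}

theorem congr (hf : SubharmonicOn f U) (h : Set.EqOn f g U) : SubharmonicOn g U := by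
  have hsphere {z : ℂ} {r : ℝ} (hr : 0 < r) (hU : Metric.closedBall z r ⊆ U) :
      Set.EqOn f g (Metric.sphere z |r|) := fun w hw =>
    h (hU (Metric.sphere_subset_closedBall (by rwa [abs_of_pos hr] at hw)))
  refine ⟨hf.isOpen, fun z hz a ha => ?_, fun z r hr hU =>
    (circleIntegrable_congr (hsphere hr hU)).1 (hf.circleIntegrable z r hr hU),
    fun z r hr hU => ?_⟩
  · filter_upwards [hf.upperSemicontinuousOn z hz a ((h hz).trans_lt ha), self_mem_nhdsWithin]
      with w hw hwU
    exact (h hwU).symm.trans_lt hw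
  · rw [← h (hU (Metric.mem_closedBall_self hr.le)),
      ← Real.circleAverage_congr_sphere (hsphere hr hU)]
    exact hf.le_circleAverage z r hr hU

theorem add_const (hf : SubharmonicOn f U) (c : ℝ) : SubharmonicOn (fun z => f z + c) U := by
  refine ⟨hf.isOpen, hf.upperSemicontinuousOn.add
    continuousOn_const.upperSemicontinuousOn, fun z r hr hU =>
    (hf.circleIntegrable z r hr hU).fun_add (circleIntegrable_const _ _ _), fun z r hr hU => ?_⟩
  rw [Real.circleAverage_fun_add (hf.circleIntegrable z r hr hU) (circleIntegrable_const _ _ _),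
    Real.circleAverage_const]
  gcongr
  exact hf.le_circleAverage z r hr hU

theorem measurable_indicator (hf : SubharmonicOn f U) : Measurable (U.indicator f) := by
  classical
  rw [← Set.piecewise_eq_indicator]
  refine measurable_of_restrict_of_restrict_compl hf.isOpen.measurableSet ?_ ?_
  · rw [Set.domRestrict_piecewise]
    exact (upperSemicontinuousOn_iff_restrict.2 hf.upperSemicontinuousOn).measurable
  · rw [Set.domRestrict_piecewise_compl]
    exact measurable_const

theorem tendsto_circleAverage (hf : SubharmonicOn f U) {z : ℂ} (hz : z ∈ U) :
    Tendsto (Real.circleAverage f z) (𝓝[>] 0) (𝓝 (f z)) := by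
  have hball {V : Set ℂ} (hV : V ∈ 𝓝 z) : ∀ᶠ r in 𝓝[>] (0 : ℝ), Metric.closedBall z r ⊆ V :=
    (eventually_closedBall_subset hV).filter_mono nhdsWithin_le_nhds
  have hU := hball (hf.isOpen.mem_nhds hz)
  refine tendsto_order.2 ⟨fun a ha => ?_, fun a ha => ?_⟩
  · filter_upwards [self_mem_nhdsWithin, hU] with r hr hrU
    exact ha.trans_le (hf.le_circleAverage z r hr hrU)
  · obtain ⟨b, hzb, hba⟩ := exists_between ha
    have husc : ∀ᶠ w in 𝓝 z, f w < b := by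
      rw [← hf.isOpen.nhdsWithin_eq hz]
      exact hf.upperSemicontinuousOn z hz b hzb
    filter_upwards [self_mem_nhdsWithin, hU, hball husc] with r hr hrU hrb
    refine lt_of_le_of_lt (Real.circleAverage_mono_on_of_le_circle
      (hf.circleIntegrable z r hr hrU) fun w hw => ?_) hba
    rw [abs_of_pos hr] at hw
    exact (hrb (Metric.sphere_subset_closedBall hw)).le

end SubharmonicOn

theorem tendsto_circleAverage_mul {φ w : ℂ → ℝ} {z : ℂ} (hφ : Continuous φ)
    (hw : IsBoundedMeasurableOn w Set.univ)
    (hlim : Tendsto (Real.circleAverage w z) (𝓝[>] 0) (𝓝 (w z))) :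
    Tendsto (Real.circleAverage (fun ζ => φ ζ * w ζ) z) (𝓝[>] 0) (𝓝 (φ z * w z)) := by
  obtain ⟨C, hC⟩ := hw.exists_norm_le
  have herr : Tendsto (fun r => Real.circleAverage (fun ζ => (φ ζ - φ z) * w ζ) z r) (𝓝[>] 0)
      (𝓝 0) := by
    have hsmall : Tendsto (fun ζ => (φ ζ - φ z) * w ζ) (𝓝 z) (𝓝 0) := by
      refine (hφ.sub continuous_const).tendsto' z 0 (sub_self _) |>.zero_mul_isBoundedUnder_le ?_
      exact isBoundedUnder_of ⟨C, hC⟩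
    refine Metric.tendsto_nhds.2 fun ε hε => ?_
    filter_upwards [(eventually_closedBall_subset
      (hsmall.eventually (Metric.closedBall_mem_nhds 0 (half_pos hε)))).filter_mono
        nhdsWithin_le_nhds, self_mem_nhdsWithin] with r hr hr0
    rw [dist_zero_right]
    refine (norm_circleAverage_le (.of_forall fun θ => ?_)).trans_lt (half_lt_self hε)
    simpa using hr (circleMap_mem_closedBall z (le_of_lt hr0) θ)
  have hci {ψ : ℂ → ℝ} {r : ℝ} (hψ : Continuous ψ) : CircleIntegrable (fun ζ => ψ ζ * w ζ) z r :=
    (circleIntegrable_of_norm_le hw.1 fun ζ _ => hC ζ).continuousOn_mul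
      hψ.continuousOn
  have hsplit (r : ℝ) : Real.circleAverage (fun ζ => φ ζ * w ζ) z r =
      φ z * Real.circleAverage w z r +
        Real.circleAverage (fun ζ => (φ ζ - φ z) * w ζ) z r := by
    simp only [← smul_eq_mul (φ z)]
    rw [← Real.circleAverage_fun_smul, ← Real.circleAverage_fun_add]
    · congr 1
      ext ζ
      simp only [smul_eq_mul]
      ring
    · exact hci continuous_const
    · exact hci (hφ.sub continuous_const)
  simpa only [← hsplit, add_zero] using (hlim.const_mul (φ z)).add herr

theorem closedBall_subset_of_abs_im_lt {z : ℂ} {r a : ℝ} (h : |z.im| + r < a) :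
    Metric.closedBall z r ⊆ {w : ℂ | |w.im| < a} := fun w hw => by
  have him := (Complex.abs_im_le_norm (w - z)).trans (mem_closedBall_iff_norm.1 hw)
  rw [Complex.sub_im] at him
  exact (by linarith [abs_sub_abs_le_abs_sub w.im z.im] : |w.im| < a)

theorem sum_abs_mul_sq_norm_sliceCoeff_cutoff_mul_le {w : ℂ → ℝ} {B : ℝ}
    (hw : SubharmonicOn w {z : ℂ | |z.im| < 1}) (hmeas : Measurable w)
    (hwB : ∀ z, w z ∈ Set.Icc 0 B) (S : Finset ℤ) :
    ∑ k ∈ S, |(k : ℝ)| * ‖sliceCoeff (fun z => ((cutoff z * w z : ℝ) : ℂ)) k 0‖ ^ 2 ≤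
      90 * volume.real (square 3) * B ^ 2 := by
  have hwb : IsBoundedMeasurableOn w Set.univ := ⟨hmeas.stronglyMeasurable, ⟨B, fun z =>
    (Real.norm_of_nonneg (hwB z).1).trans_le (hwB z).2⟩, fun z hz => absurd (Set.mem_univ z) hz⟩
  have hprod := isBoundedMeasurableOn_cutoff.mul hwb
  have hprodC : IsBoundedMeasurableOn (fun z => ((cutoff z * w z : ℝ) : ℂ)) (square (2 : ℕ)) :=
    ⟨Complex.continuous_ofReal.comp_stronglyMeasurable hprod.1, hprod.2.imp fun C hC z => by
      simpa only [Complex.norm_real] using hC z, fun z hz => by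
      simpa using hprod.3 z (by simpa using hz)⟩
  refine (sum_abs_mul_sq_norm_sliceCoeff_zero_le hprodC (a := -1 / 2) (fun z hz => ?_) (fun x => ?_)
    (D := volume.real (square 3) * (2 * B) ^ 2) ?_ S).trans_eq (by push_cast; ring)
  · have h0 : cutoff z = 0 := by
      by_contra h
      have him := abs_lt.1 (show |z.im| < 1 / 2 by linarith [(cutoff_ne_zero_iff.1 h).2])
      exact hz ⟨by linarith, by linarith⟩
    rw [h0, zero_mul, Complex.ofReal_zero]
  · obtain ⟨C, hC⟩ := hprod.exists_norm_le
    have hcast (r : ℝ) := Complex.ofRealCLM.circleAverage_comp_comm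
      (circleIntegrable_of_norm_le (c := x) (r := r) hprod.1 fun ζ _ => hC ζ)
    have hlim := tendsto_circleAverage_mul (z := x) lipschitzWith_cutoff.continuous hwb
      (hw.tendsto_circleAverage (by simp))
    exact ((Complex.continuous_ofReal.tendsto _).comp hlim).congr fun r => (hcast r).symm
  · filter_upwards [self_mem_nhdsWithin, eventually_abs_le_one_nhdsGT,
      (eventually_lt_nhds one_half_pos).filter_mono nhdsWithin_le_nhds] with r hr0 hr1 hr
    have h := circleAverage_diffEnergy_mul_le isBoundedMeasurableOn_cutoff lipschitzWith_cutoff hwb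
      hwB hr1 fun z hz => hw.le_circleAverage z r hr0
        (closedBall_subset_of_abs_im_lt (by linarith [(cutoff_ne_zero_iff.1 hz).2]))
    have hnorm : diffEnergy (fun z => ((cutoff z * w z : ℝ) : ℂ)) =
        diffEnergy fun z => cutoff z * w z := by
      ext h
      simp only [diffEnergy, ← Complex.ofReal_sub, Complex.norm_real]
    rw [hnorm]
    convert h using 3
    · norm_num
    · rfl

end Subharmonic

namespace IsBoundedSubharmonicExtension

variable {v : ℂ → ℝ} {u : UnitAddCircle → ℝ} {B : ℝ}

theorem norm_le (h : IsBoundedSubharmonicExtension v u B) (x : UnitAddCircle) : ‖u x‖ ≤ B := by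
  induction x using QuotientAddGroup.induction_on with
  | H x => exact h.extends_real x ▸ h.abs_le x (by simp)

theorem measurable (h : IsBoundedSubharmonicExtension v u B) : Measurable u := by
  have hu : u = fun x => {z : ℂ | |z.im| < 1}.indicator v (measurableEquivIoc 1 0 x : ℝ) := by
    ext x
    rw [Set.indicator_of_mem (by simp), h.extends_real]
    exact congrArg u coe_equivIoc.symm
  rw [hu]
  exact h.subharmonicOn.measurable_indicator.comp (Complex.measurable_ofReal.comp
    (measurable_subtype_coe.comp (measurableEquivIoc 1 0).measurable))

theorem memLp (h : IsBoundedSubharmonicExtension v u B) (p : ENNReal) : MemLp u p :=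
  .of_bound h.measurable.aestronglyMeasurable B (.of_forall h.norm_le)

theorem halfEnergyLE (h : IsBoundedSubharmonicExtension v u B) :
    HalfEnergyLE (fun x => (u x : ℂ)) (360 * volume.real (square 3) * B ^ 2) := by
  have := isProbabilityMeasure_volume_unitAddCircle
  set w := {z : ℂ | |z.im| < 1}.indicator fun z => v z + B with hw
  have hsub := h.subharmonicOn.add_const B
  have hwB (z : ℂ) : w z ∈ Set.Icc 0 (2 * B) := by
    by_cases hz : z ∈ {z : ℂ | |z.im| < 1}
    · have := _root_.abs_le.1 (h.abs_le z hz)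
      rw [hw, Set.indicator_of_mem hz]
      constructor <;> linarith
    · rw [hw, Set.indicator_of_notMem hz]
      exact ⟨le_rfl, by linarith [(abs_nonneg _).trans (h.abs_le 0 (by simp))]⟩
  have hint : Integrable fun x => ((u x + B : ℝ) : ℂ) :=
    (((h.memLp 1).integrable le_rfl).add (integrable_const B)).ofReal
  have hcoeff (k : ℤ) : sliceCoeff (fun z => ((cutoff z * w z : ℝ) : ℂ)) k 0 =
      fourierCoeff (fun x => ((u x + B : ℝ) : ℂ)) k := by
    rw [fourierCoeff_eq_integral_volume, ← integral_cutoff_mul (hint.bdd_mul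
      (map_continuous (fourier (-k))).aestronglyMeasurable
      (.of_forall fun x => (norm_fourier_apply _ _).le)), sliceCoeff]
    refine integral_congr_ae (.of_forall fun x => ?_)
    simp [hw, h.extends_real]
    ring
  have henergy : HalfEnergyLE (fun x => ((u x + B : ℝ) : ℂ))
      (360 * volume.real (square 3) * B ^ 2) := fun S => by
    have := sum_abs_mul_sq_norm_sliceCoeff_cutoff_mul_le (w := w)
      (hsub.congr Set.eqOn_indicator.symm) hsub.measurable_indicator hwB S
    simp only [hcoeff] at this
    linarith
  simpa using henergy.sub_const hint B

end IsBoundedSubharmonicExtension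

theorem theorem2p3_general (A : ℝ) :
    ∃ σ : ℝ, 0 < σ ∧
      ∀ (c : ℝ), 0 < c → ∀ (E : ℝ), ∃ c' : ℝ, 0 < c' ∧
        ∀ (u : UnitAddCircle → ℝ), MemLp u 2 → HalfEnergyLE (fun x => (u x : ℂ)) E →
        ∀ (ω : UnitAddCircle) (M : ℕ), 1 ≤ M →
          (∀ k : ℤ, 0 < |k| → |k| ≤ (M : ℤ) → c * |(k : ℝ)| ^ (-A) < ‖k • ω‖) →
          volume {x : UnitAddCircle |
              (M : ℝ) ^ (-σ) < |fejerAverage u ω M x - ∫ y : UnitAddCircle, u y|}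
            < ENNReal.ofReal (Real.exp (-(c' * (M : ℝ) ^ σ))) := by
  have hA : 0 ≤ max A 0 := le_max_right A 0
  refine ⟨1 / (4 * (1 + max A 0)), by positivity, fun c hc E => ?_⟩
  obtain ⟨c', hc', h⟩ := exists_forall_measureReal_lt_abs_fejerAverage_sub_integral_lt hA hc
    (abs_nonneg E)
  refine ⟨c', hc', fun u hu hE ω M hM hω => ?_⟩
  rw [← ofReal_measureReal, ENNReal.ofReal_lt_ofReal_iff (Real.exp_pos _)]
  refine h u hu (hE.mono (le_abs_self E)) ω M (by omega) fun k hk hkM =>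
    lt_of_le_of_lt ?_ (hω k hk hkM)
  gcongr
  · exact_mod_cast hk
  · exact le_max_left A 0

theorem theorem2p3 (A : ℝ) :
    ∃ σ : ℝ, 0 < σ ∧
      ∀ (c : ℝ), 0 < c → ∀ (B : ℝ), ∃ c' : ℝ, 0 < c' ∧
        ∀ (u : UnitAddCircle → ℝ) (v : ℂ → ℝ), IsBoundedSubharmonicExtension v u B →
        ∀ (ω : UnitAddCircle) (M : ℕ), 1 ≤ M →
          (∀ k : ℤ, 0 < |k| → |k| ≤ (M : ℤ) → c * |(k : ℝ)| ^ (-A) < ‖k • ω‖) →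
          MeasureTheory.volume
              {x : UnitAddCircle |
                (M : ℝ) ^ (-σ) < |fejerAverage u ω M x - ∫ y : UnitAddCircle, u y|}
            < ENNReal.ofReal (Real.exp (-(c' * (M : ℝ) ^ σ))) := by
  obtain ⟨σ, hσ, h⟩ := theorem2p3_general A
  refine ⟨σ, hσ, fun c hc B => ?_⟩
  obtain ⟨c', hc', h'⟩ := h c hc (360 * volume.real (square 3) * B ^ 2)
  exact ⟨c', hc', fun u v huv => h' u (huv.memLp 2) huv.halfEnergyLE⟩
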